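/- Let $K$ be a field of characteristic $0$ (for instance $\mathbb{C}$), and let $G=(V,E)$ be a finite, connected, directed graph (loops and parallel edges are allowed) together with a drawing in the plane without crossings, in which vertices are distinct points and edges are polygonal arcs. Let $v_0\in V$, let $e_G=|E|$, and label every edge $e\in E$ by $\ell(e)=(x+a_e y)^2\in K[x,y]$ with $a_e\in K$. Let $\mathsf{Spl}_2(G,\ell;v_0)$ be the $K$-vector space of all families $p=(p(v))_{v\in V}$ of polynomials in $K[x,y]$, each zero or homogeneous of degree $2$, such that $p(v_0)=0$ and $p(u)-p(v)$ is a multiple of $\ell(e)$ for every edge $e$ from $u$ to $v$. Let $F_1,\dots,F_{f_G}$ be the bounded faces of the drawing, that is, the bounded connected components of its complement in the plane. The cycle basis matrix $M$ is the $f_G\times e_G$ matrix with entry $\varepsilon_{F,e}=1$ if $e$ lies on the boundary of $F$ and points clockwise around $F$ (that is, $F$ lies to the right of $e$ and not also to its left), $\varepsilon_{F,e}=-1$ if $e$ lies on the boundary of $F$ and points counterclockwise around $F$ ($F$ lies to the left of $e$ and not also to its right), and $\varepsilon_{F,e}=0$ otherwise. The extended cycle basis matrix $M^{\mathsf{ext}}$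 is the $3f_G\times e_G$ matrix over $K$ obtained from $M$ by replacing, for each bounded face $F$, the row $(\varepsilon_{F,e})_{e\in E}$ by the three rows $(\varepsilon_{F,e})_{e\in E}$, $(\varepsilon_{F,e}a_e)_{e\in E}$, $(\varepsilon_{F,e}a_e^2)_{e\in E}$. Then $$\dim_K \mathsf{Spl}_2(G,\ell;v_0)=e_G-\mathsf{rank}(M^{\mathsf{ext}}).$$ -/

import Mathlib

/-- A directed multigraph with vertex type `V` and edge type `E`; loops and parallel edges are
allowed. -/
structure DirGraph (V E : Type*) where
  /-- the tail of an edge -/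
  src : E → V
  /-- the head of an edge -/
  tgt : E → V

namespace DirGraph

variable {V E : Type*}

/-- The underlying undirected graph is connected: any two vertices are joined by a path that may
use edges in either direction. -/
def Connected (G : DirGraph V E) : Prop :=
  Nonempty V ∧ ∀ u v : V, Relation.EqvGen (fun u v => ∃ e, G.src e = u ∧ G.tgt e = v) u v

/-! ### Splines -/

/-- The `R`-module of splines on the edge-labelled graph `(G, ℓ)`: vertex labellings whose
difference along every edge is a multiple of the label of that edge. -/
def Spl {R : Type*} [CommRing R] (G : DirGraph V E) (ℓ : E → R) : Submodule R (V → R) where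
  carrier := {p | ∀ e, ℓ e ∣ p (G.src e) - p (G.tgt e)}
  add_mem' := by
    intro p q hp hq e
    have h := dvd_add (hp e) (hq e)
    have h' : (p + q) (G.src e) - (p + q) (G.tgt e)
        = (p (G.src e) - p (G.tgt e)) + (q (G.src e) - q (G.tgt e)) := by
      simp only [Pi.add_apply]; ring
    rw [h']; exact h
  zero_mem' := by intro e; simp
  smul_mem' := by
    intro c p hp e
    have h := (hp e).mul_left c
    simpa only [Pi.smul_apply, smul_eq_mul, mul_sub] using h

/-- `Spl_d(G, ℓ)`: the splines over `K[x, y]` all of whose vertex labels are zero or homogeneous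
of degree `d`, as a vector space over `K`. -/
noncomputable def SplDeg {K : Type*} [Field K] (G : DirGraph V E) (ℓ : E → MvPolynomial (Fin 2) K) (d : ℕ) :
    Submodule K (V → MvPolynomial (Fin 2) K) :=
  (G.Spl ℓ).restrictScalars K ⊓
    Submodule.pi Set.univ (fun _ => MvPolynomial.homogeneousSubmodule (Fin 2) K d)

/-- `Spl_d(G, ℓ; v₀)`: the splines in `Spl_d(G, ℓ)` that vanish at the vertex `v₀`. -/
noncomputable def SplDegAt {K : Type*} [Field K] (G : DirGraph V E) (ℓ : E → MvPolynomial (Fin 2) K) (d : ℕ)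
    (v₀ : V) : Submodule K (V → MvPolynomial (Fin 2) K) :=
  G.SplDeg ℓ d ⊓ LinearMap.ker (LinearMap.proj v₀)

/-- The homogeneous edge-labelling `e ↦ (x + a_e y)²`. -/
noncomputable def homLabel {K : Type*} [Field K] (a : E → K) : E → MvPolynomial (Fin 2) K :=
  fun e => (MvPolynomial.X 0 + MvPolynomial.C (a e) * MvPolynomial.X 1) ^ 2

/-! ### Plane drawings -/

/-- A drawing of `G` in the plane `ℂ` without crossings. Vertices are distinct points, and the
edge `e` is a polygonal arc (a polygon if `e` is a loop) from its tail to its head, given by its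
corners `corner e 0, …, corner e (len e)`. The pairs `(i, t)` with `i < len e`, `0 ≤ t < 1`,
`(i, t) ≠ (0, 0)` parametrize the interior of this arc. -/
structure PlaneDrawing (G : DirGraph V E) where
  /-- the point representing a vertex -/
  pos : V → ℂ
  /-- the number of segments of the arc of an edge -/
  len : E → ℕ
  /-- the corners of the arc of an edge; only the indices up to `len e` matter -/
  corner : E → ℕ → ℂ
  pos_injective : Function.Injective pos
  len_pos : ∀ e, 0 < len e
  corner_zero : ∀ e, corner e 0 = pos (G.src e)
  corner_len : ∀ e, corner e (len e) = pos (G.tgt e)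
  /-- the interiors of the arcs avoid the vertices -/
  interior_ne_pos : ∀ (e : E) (i : ℕ) (t : ℝ) (v : V),
    i < len e → t ∈ Set.Ico (0 : ℝ) 1 → 0 < (i : ℝ) + t →
      AffineMap.lineMap (corner e i) (corner e (i + 1)) t ≠ pos v
  /-- every arc is simple, and the interiors of different arcs are disjoint -/
  interior_injective : ∀ (e : E) (i : ℕ) (t : ℝ) (e' : E) (i' : ℕ) (t' : ℝ),
    i < len e → t ∈ Set.Ico (0 : ℝ) 1 → 0 < (i : ℝ) + t →
    i' < len e' → t' ∈ Set.Ico (0 : ℝ) 1 → 0 < (i' : ℝ) + t' →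
      AffineMap.lineMap (corner e i) (corner e (i + 1)) t =
        AffineMap.lineMap (corner e' i') (corner e' (i' + 1)) t' →
      e = e' ∧ i = i' ∧ t = t'

namespace PlaneDrawing

variable {G : DirGraph V E}

/-- The point with parameter `t` on the `i`-th segment of the arc of `e`. -/
noncomputable def point (D : G.PlaneDrawing) (e : E) (i : ℕ) (t : ℝ) : ℂ :=
  AffineMap.lineMap (D.corner e i) (D.corner e (i + 1)) t

/-- The subset of the plane covered by the drawing. -/
def support (D : G.PlaneDrawing) : Set ℂ :=
  Set.range D.pos ∪ ⋃ (e : E) (i : ℕ) (_ : i < D.len e),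
    segment ℝ (D.corner e i) (D.corner e (i + 1))

/-- `F` is a face: a connected component of the complement of the drawing. -/
def IsFace (D : G.PlaneDrawing) (F : Set ℂ) : Prop :=
  ∃ z ∈ (D.support)ᶜ, F = connectedComponentIn (D.support)ᶜ z

/-- The type of bounded faces. -/
def BoundedFace (D : G.PlaneDrawing) : Type :=
  {F : Set ℂ // D.IsFace F ∧ Bornology.IsBounded F}

/-- The set `F` lies immediately to the right of the edge `e`, travelled from tail to head:
from each point in the relative interior of each segment of the arc, a small step along the
right-hand normal leads into `F`. -/
def OnRight (D : G.PlaneDrawing) (F : Set ℂ) (e : E) : Prop :=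
  ∀ i < D.len e, ∀ t ∈ Set.Ioo (0 : ℝ) 1, ∀ᶠ δ : ℝ in nhdsWithin 0 (Set.Ioi 0),
    D.point e i t - (δ : ℂ) * (Complex.I * (D.corner e (i + 1) - D.corner e i)) ∈ F

/-- The set `F` lies immediately to the left of the edge `e`, travelled from tail to head. -/
def OnLeft (D : G.PlaneDrawing) (F : Set ℂ) (e : E) : Prop :=
  ∀ i < D.len e, ∀ t ∈ Set.Ioo (0 : ℝ) 1, ∀ᶠ δ : ℝ in nhdsWithin 0 (Set.Ioi 0),
    D.point e i t + (δ : ℂ) * (Complex.I * (D.corner e (i + 1) - D.corner e i)) ∈ F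

open Classical in
/-- The cycle basis matrix. An edge points clockwise around `F` if `F` lies to its right, and
counterclockwise if `F` lies to its left. An edge with `F` on both sides (a bridge running inside
`F`) is on no cycle, and its entry is `0`. -/
noncomputable def cycleBasisMatrix (D : G.PlaneDrawing) : Matrix D.BoundedFace E ℤ :=
  fun F e =>
    if D.OnRight F.1 e ∧ ¬ D.OnLeft F.1 e then 1
    else if D.OnLeft F.1 e ∧ ¬ D.OnRight F.1 e then -1
    else 0

/-- The extended cycle basis matrix: each row `(ε_e)_e` of the cycle basis matrix is replaced by
the three rows `(ε_e)_e`, `(ε_e a_e)_e`, `(ε_e a_e²)_e`. -/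
noncomputable def extCycleBasisMatrix {K : Type*} [Field K] (D : G.PlaneDrawing) (a : E → K) :
    Matrix (D.BoundedFace × Fin 3) E K :=
  fun r e => (D.cycleBasisMatrix r.1 e : K) * a e ^ (r.2 : ℕ)

end PlaneDrawing

end DirGraph

/-! If a quadratic form is divisible by (x + a_e y)², the quotient is a scalar c_e. So a spline is
determined, by connectedness and p(v₀) = 0, by the vector c in K^E. Comparing coefficients of x², xy
(with its factor 2) and y², a vector c comes from a spline exactly when each of the three weightings
c_e, c_e a_e, c_e a_e² is a coboundary, that is, the family of edge differences of a function on the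
vertices. If coboundaries are the weightings that sum to zero around every bounded face, then the
vectors c form the kernel of the extended matrix (`map_edgeCoeff_eq_ker`), and rank-nullity gives
the formula.

A coboundary sums to zero around a face because each row of the cycle basis matrix is a cycle: on a
small circle around a node, the jumps of the indicator function of the face add up to zero
(`sum_jumps_at_node`, `sum_cycleBasisMatrix_mul_sub`).

For the converse, every integral cycle y must be a combination of boundaries of bounded faces. The
coefficients are winding numbers: the function W(p) = ∑ y_s log((b_s - p)/(a_s - p)), summed over
the segments from a_s to b_s, has derivative zero off the drawing, jumps by 2πi y_s across the
segment s and tends to 0 at infinity (`exists_winding`). Neither Euler's formula nor the Jordan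
curve theorem enters. A weighting that vanishes on the face boundaries thus vanishes on all integral
cycles, and summing it along paths to v₀ gives the potential (`exists_potential`). -/

section

open Set Filter Topology

/-! ### Finite arrangements of plane segments -/

/-- A finite family of nondegenerate segments in the plane, meeting each other only in a finite
set of nodes that contains all their endpoints. -/
structure SegmentArrangement (S : Type*) where
  /-- the first endpoint of a segment -/
  fst : S → ℂ
  /-- the second endpoint of a segment -/
  snd : S → ℂ
  /-- the set of nodes -/
  nodes : Set ℂ
  nodes_finite : nodes.Finite
  fst_mem : ∀ s, fst s ∈ nodes
  snd_mem : ∀ s, snd s ∈ nodes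
  fst_ne_snd : ∀ s, fst s ≠ snd s
  notMem_nodes : ∀ s, ∀ p ∈ openSegment ℝ (fst s) (snd s), p ∉ nodes
  eq_of_mem : ∀ s t, ∀ p ∈ openSegment ℝ (fst s) (snd s),
    p ∈ openSegment ℝ (fst t) (snd t) → s = t

/-- The open half plane to the left of the line from `a` to `b`. -/
def leftSide (a b : ℂ) : Set ℂ := {p | 0 < ((p - a) / (b - a)).im}

theorem mem_leftSide {a b p : ℂ} : p ∈ leftSide a b ↔ 0 < ((p - a) / (b - a)).im := Iff.rfl

theorem convex_leftSide (a b : ℂ) : Convex ℝ (leftSide a b) := by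
  intro x hx y hy s t hs ht hst
  rw [mem_leftSide] at *
  have h : (s • x + t • y - a) / (b - a)
      = (s : ℂ) * ((x - a) / (b - a)) + (t : ℂ) * ((y - a) / (b - a)) := by
    have h1 : (s : ℂ) + t = 1 := by exact_mod_cast hst
    have h2 : (s • x + t • y - a) = (s : ℂ) * (x - a) + t * (y - a) := by
      simp only [Complex.real_smul]
      linear_combination a * h1
    rw [h2]; ring
  rw [h, Complex.add_im, Complex.im_ofReal_mul, Complex.im_ofReal_mul]
  rcases hs.eq_or_lt with h0 | h0
  · have : t = 1 := by linarith
    subst h0; subst this; simpa using hy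
  · have := mul_pos h0 hx
    have := mul_nonneg ht hy.le
    linarith

theorem notMem_leftSide_of_mem_openSegment {a b p : ℂ} (hab : a ≠ b)
    (hp : p ∈ openSegment ℝ a b) : p ∉ leftSide a b := by
  rw [openSegment_eq_image_lineMap] at hp
  obtain ⟨t, -, rfl⟩ := hp
  have hab' : b - a ≠ 0 := sub_ne_zero.2 hab.symm
  simp [leftSide, AffineMap.lineMap_apply, hab']

theorem tendsto_normal_leftSide {a b m : ℂ} (hab : a ≠ b) (hm : m ∈ openSegment ℝ a b) :
    Tendsto (fun δ : ℝ => m + (δ : ℂ) * (Complex.I * (b - a))) (𝓝[>] 0) (𝓝[leftSide a b] m) := by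
  have hab' : b - a ≠ 0 := sub_ne_zero.2 hab.symm
  refine tendsto_nhdsWithin_iff.2 ⟨?_, ?_⟩
  · have : Continuous (fun δ : ℝ => m + (δ : ℂ) * (Complex.I * (b - a))) := by fun_prop
    have := this.tendsto 0
    simp only [Complex.ofReal_zero, zero_mul, add_zero] at this
    exact this.mono_left nhdsWithin_le_nhds
  · rw [openSegment_eq_image_lineMap] at hm
    obtain ⟨t, -, rfl⟩ := hm
    filter_upwards [self_mem_nhdsWithin] with δ hδ
    have : (AffineMap.lineMap a b t + (δ : ℂ) * (Complex.I * (b - a)) - a) / (b - a)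
        = t + δ * Complex.I := by
      simp only [AffineMap.lineMap_apply, vsub_eq_sub, vadd_eq_add, Complex.real_smul]
      field_simp
      ring
    simpa [leftSide, this] using hδ

theorem neBot_nhdsWithin_leftSide {a b m : ℂ} (hab : a ≠ b) (hm : m ∈ openSegment ℝ a b) :
    (𝓝[leftSide a b] m).NeBot :=
  (tendsto_normal_leftSide hab hm).neBot

theorem isCompact_segment_complex (a b : ℂ) : IsCompact (segment ℝ a b) := by
  rw [segment_eq_image_lineMap]
  exact isCompact_Icc.image AffineMap.lineMap_continuous

namespace SegmentArrangement

variable {S : Type*} (𝒜 : SegmentArrangement S)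

/-- The subset of the plane covered by the arrangement. -/
def carrier : Set ℂ := 𝒜.nodes ∪ ⋃ s, segment ℝ (𝒜.fst s) (𝒜.snd s)

/-- The start of a dart (a segment with an orientation). -/
def tail (d : S × Bool) : ℂ := if d.2 then 𝒜.fst d.1 else 𝒜.snd d.1

/-- The end of a dart. -/
def head (d : S × Bool) : ℂ := if d.2 then 𝒜.snd d.1 else 𝒜.fst d.1

/-- A component of the complement. -/
def IsComponent (F : Set ℂ) : Prop := ∃ z ∈ 𝒜.carrierᶜ, F = connectedComponentIn 𝒜.carrierᶜ z

theorem tail_rev (d : S × Bool) : 𝒜.tail (d.1, !d.2) = 𝒜.head d := by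
  rcases d with ⟨s, _ | _⟩ <;> rfl

theorem head_rev (d : S × Bool) : 𝒜.head (d.1, !d.2) = 𝒜.tail d := by
  rcases d with ⟨s, _ | _⟩ <;> rfl

theorem tail_ne_head (d : S × Bool) : 𝒜.tail d ≠ 𝒜.head d := by
  rcases d with ⟨s, _ | _⟩
  · exact (𝒜.fst_ne_snd s).symm
  · exact 𝒜.fst_ne_snd s

theorem openSegment_dart (d : S × Bool) :
    openSegment ℝ (𝒜.tail d) (𝒜.head d) = openSegment ℝ (𝒜.fst d.1) (𝒜.snd d.1) := by
  rcases d with ⟨s, _ | _⟩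
  · exact openSegment_symm ..
  · rfl

theorem segment_subset (s : S) :
    segment ℝ (𝒜.fst s) (𝒜.snd s) ⊆ 𝒜.nodes ∪ openSegment ℝ (𝒜.fst s) (𝒜.snd s) := by
  rw [← insert_endpoints_openSegment]
  rintro p (rfl | rfl | hp)
  · exact Or.inl (𝒜.fst_mem s)
  · exact Or.inl (𝒜.snd_mem s)
  · exact Or.inr hp

theorem IsComponent.eq_of_mem {𝒜 : SegmentArrangement S} {F F' : Set ℂ} (hF : 𝒜.IsComponent F)
    (hF' : 𝒜.IsComponent F') {p : ℂ} (hp : p ∈ F) (hp' : p ∈ F') : F = F' := by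
  obtain ⟨z, -, rfl⟩ := hF
  obtain ⟨z', -, rfl⟩ := hF'
  rw [connectedComponentIn_eq hp, connectedComponentIn_eq hp']

theorem IsComponent.eq_of_eventually {𝒜 : SegmentArrangement S} {F F' : Set ℂ}
    (hF : 𝒜.IsComponent F) (hF' : 𝒜.IsComponent F') {l : Filter ℂ} [l.NeBot]
    (hp : ∀ᶠ p in l, p ∈ F) (hp' : ∀ᶠ p in l, p ∈ F') : F = F' := by
  obtain ⟨p, h, h'⟩ := (hp.and hp').exists
  exact hF.eq_of_mem hF' h h'

theorem IsComponent.eq_of_isPreconnected {𝒜 : SegmentArrangement S} {F F' : Set ℂ}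
    (hF : 𝒜.IsComponent F) (hF' : 𝒜.IsComponent F') {C : Set ℂ} (hC : IsPreconnected C)
    (hCU : C ⊆ 𝒜.carrierᶜ) {p p' : ℂ} (hp : p ∈ F) (hpC : p ∈ C) (hp' : p' ∈ F') (hpC' : p' ∈ C) :
    F = F' := by
  obtain ⟨z, hz, rfl⟩ := hF
  refine IsComponent.eq_of_mem (p := p') ⟨z, hz, rfl⟩ hF' ?_ hp'
  rw [connectedComponentIn_eq hp]
  exact hC.subset_connectedComponentIn hpC hCU hpC'

variable [Finite S]

theorem isClosed_carrier : IsClosed 𝒜.carrier :=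
  𝒜.nodes_finite.isClosed.union
    (isClosed_iUnion_of_finite fun _ => (isCompact_segment_complex _ _).isClosed)

/-- Near an interior point of a segment, the arrangement consists of that segment only. -/
theorem eventually_mem_openSegment (s : S) {m : ℂ} (hm : m ∈ openSegment ℝ (𝒜.fst s) (𝒜.snd s)) :
    ∀ᶠ p in 𝓝 m, p ∈ 𝒜.carrier → p ∈ openSegment ℝ (𝒜.fst s) (𝒜.snd s) := by
  have hc : IsClosed (𝒜.nodes ∪ ⋃ s' : {s' // s' ≠ s}, segment ℝ (𝒜.fst s') (𝒜.snd s')) :=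
    𝒜.nodes_finite.isClosed.union
      (isClosed_iUnion_of_finite fun _ => (isCompact_segment_complex _ _).isClosed)
  have hm' : m ∉ 𝒜.nodes ∪ ⋃ s' : {s' // s' ≠ s}, segment ℝ (𝒜.fst s') (𝒜.snd s') := by
    rintro (h | h)
    · exact 𝒜.notMem_nodes s m hm h
    · obtain ⟨⟨s', hs'⟩, h⟩ := mem_iUnion.1 h
      rcases 𝒜.segment_subset s' h with h | h
      · exact 𝒜.notMem_nodes s m hm h
      · exact hs' (𝒜.eq_of_mem _ _ m h hm)
  filter_upwards [hc.isOpen_compl.mem_nhds hm'] with p hp hpX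
  by_contra hps
  refine hp ?_
  rcases hpX with h | h
  · exact Or.inl h
  · obtain ⟨s', h⟩ := mem_iUnion.1 h
    rcases 𝒜.segment_subset s' h with h' | h'
    · exact Or.inl h'
    · refine Or.inr (mem_iUnion.2 ⟨⟨s', ?_⟩, h⟩)
      rintro rfl
      exact hps h'

/-- A small half disc on the left of the dart is convex and misses the arrangement, so it lies in
one component. -/
theorem exists_component_near (d : S × Bool) {m : ℂ}
    (hm : m ∈ openSegment ℝ (𝒜.tail d) (𝒜.head d)) :
    ∃ F, 𝒜.IsComponent F ∧ ∃ κ > 0, Metric.ball m κ ∩ leftSide (𝒜.tail d) (𝒜.head d) ⊆ F := by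
  have hne := 𝒜.tail_ne_head d
  have hm' := hm
  rw [openSegment_dart] at hm'
  obtain ⟨κ, hκ, h⟩ := Metric.eventually_nhds_iff_ball.1 (𝒜.eventually_mem_openSegment d.1 hm')
  have hU : Metric.ball m κ ∩ leftSide (𝒜.tail d) (𝒜.head d) ⊆ 𝒜.carrierᶜ := by
    rintro p ⟨hp, hpl⟩ hpX
    have := h p hp hpX
    rw [← openSegment_dart] at this
    exact notMem_leftSide_of_mem_openSegment hne this hpl
  have := neBot_nhdsWithin_leftSide hne hm
  obtain ⟨p, hp, hp'⟩ : ∃ p ∈ Metric.ball m κ, p ∈ leftSide (𝒜.tail d) (𝒜.head d) :=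
    this.nonempty_of_mem
      (inter_mem (nhdsWithin_le_nhds (Metric.ball_mem_nhds m hκ)) self_mem_nhdsWithin)
  exact ⟨_, ⟨p, hU ⟨hp, hp'⟩, rfl⟩, κ, hκ,
    ((convex_ball m κ).inter (convex_leftSide _ _)).isPreconnected.subset_connectedComponentIn
      ⟨hp, hp'⟩ hU⟩

/-- The component found near each interior point is locally constant along the open segment, which
is connected. -/
theorem exists_leftComponent (d : S × Bool) :
    ∃ F, 𝒜.IsComponent F ∧ ∀ m ∈ openSegment ℝ (𝒜.tail d) (𝒜.head d),
      ∀ᶠ p in 𝓝[leftSide (𝒜.tail d) (𝒜.head d)] m, p ∈ F := by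
  have hne := 𝒜.tail_ne_head d
  choose! F hF κ hκ hsub using fun m => 𝒜.exists_component_near d (m := m)
  have hev : ∀ m ∈ openSegment ℝ (𝒜.tail d) (𝒜.head d), ∀ m' ∈ Metric.ball m (κ m),
      ∀ᶠ p in 𝓝[leftSide (𝒜.tail d) (𝒜.head d)] m', p ∈ F m := by
    intro m hm m' hm'
    filter_upwards [nhdsWithin_le_nhds (Metric.isOpen_ball.mem_nhds hm'), self_mem_nhdsWithin]
      with p hp hp' using hsub m hm ⟨hp, hp'⟩
  have hself : ∀ m ∈ openSegment ℝ (𝒜.tail d) (𝒜.head d),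
      ∀ᶠ p in 𝓝[leftSide (𝒜.tail d) (𝒜.head d)] m, p ∈ F m :=
    fun m hm => hev m hm m (Metric.mem_ball_self (hκ m hm))
  have hconst : ∀ m ∈ openSegment ℝ (𝒜.tail d) (𝒜.head d),
      ∀ m' ∈ openSegment ℝ (𝒜.tail d) (𝒜.head d), F m = F m' := by
    intro m hm m' hm'
    refine (convex_openSegment _ _).isPreconnected.induction₂ (fun m m' => F m = F m') ?_
      (fun _ _ _ _ _ _ => Eq.trans) (fun _ _ _ _ => Eq.symm) hm hm'
    intro m hm
    filter_upwards [nhdsWithin_le_nhds (Metric.ball_mem_nhds m (hκ m hm)), self_mem_nhdsWithin]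
      with m' hmb hm'
    have := neBot_nhdsWithin_leftSide hne hm'
    exact (hF m hm).eq_of_eventually (hF m' hm') (hev m hm m' hmb) (hself m' hm')
  obtain ⟨m₀, hm₀⟩ : (openSegment ℝ (𝒜.tail d) (𝒜.head d)).Nonempty :=
    ⟨_, midpoint_mem_openSegment _ _⟩
  exact ⟨F m₀, hF m₀ hm₀, fun m hm => hconst m hm m₀ hm₀ ▸ hself m hm⟩

/-- The component immediately to the left of a dart. -/
noncomputable def left (d : S × Bool) : Set ℂ := (𝒜.exists_leftComponent d).choose

theorem isComponent_left (d : S × Bool) : 𝒜.IsComponent (𝒜.left d) :=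
  (𝒜.exists_leftComponent d).choose_spec.1

theorem eventually_mem_left (d : S × Bool) {m : ℂ}
    (hm : m ∈ openSegment ℝ (𝒜.tail d) (𝒜.head d)) :
    ∀ᶠ p in 𝓝[leftSide (𝒜.tail d) (𝒜.head d)] m, p ∈ 𝒜.left d :=
  (𝒜.exists_leftComponent d).choose_spec.2 m hm

theorem eventually_mem_left_rev (d : S × Bool) {m : ℂ}
    (hm : m ∈ openSegment ℝ (𝒜.tail d) (𝒜.head d)) :
    ∀ᶠ p in 𝓝[leftSide (𝒜.head d) (𝒜.tail d)] m, p ∈ 𝒜.left (d.1, !d.2) := by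
  have := 𝒜.eventually_mem_left (d.1, !d.2) (m := m)
  rw [tail_rev, head_rev] at this
  exact this (by rwa [openSegment_symm])

end SegmentArrangement

/-! ### Small circles around a node -/

/-- A function on an interval that is locally constant except for finitely many jumps changes by
the sum of its jumps. -/
theorem sub_eq_sum_jumps {M T : Type*} [AddCommGroup M] [Fintype T] {τ : T → ℝ}
    (hτ : Function.Injective τ) {a b : ℝ} (hab : a ≤ b) (hmem : ∀ d, τ d ∈ Ioo a b)
    {f : ℝ → M} {l r : T → M} (hl : ∀ d, ∀ᶠ x in 𝓝[>] τ d, f x = l d)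
    (hr : ∀ d, ∀ᶠ x in 𝓝[<] τ d, f x = r d)
    (hloc : ∀ x ∈ Icc a b, (∀ d, τ d ≠ x) → ∀ᶠ y in 𝓝 x, f y = f x) :
    f b - f a = ∑ d, (l d - r d) := by
  classical
  -- Subtracting the jumps already passed makes the function locally constant. At a jump the value
  -- of `f` is arbitrary, so it is replaced by the limit `r` from below, which matches the strict
  -- inequality in the sum.
  let g : ℝ → M := fun x => (if h : ∃ d, τ d = x then r h.choose else f x) -
    ∑ d, if τ d < x then l d - r d else 0
  have hg₁ : ∀ x, (∀ d, τ d ≠ x) → g x = f x - ∑ d, if τ d < x then l d - r d else 0 := by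
    intro x hx
    have : ¬ ∃ d, τ d = x := by simpa using hx
    simp only [g, dif_neg this]
  have hg₂ : ∀ d₀, g (τ d₀) = r d₀ - ∑ d, if τ d < τ d₀ then l d - r d else 0 := by
    intro d₀
    have h : ∃ d, τ d = τ d₀ := ⟨d₀, rfl⟩
    have h' : h.choose = d₀ := hτ h.choose_spec
    simp only [g, dif_pos h, h']
  have hlt : ∀ x, ∀ᶠ y in 𝓝 x, ∀ d, τ d ≠ x → (τ d < y ↔ τ d < x) ∧ τ d ≠ y := by
    intro x
    refine eventually_all.2 fun d => ?_
    rcases lt_trichotomy (τ d) x with h | h | h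
    · filter_upwards [lt_mem_nhds h] with y hy _ using ⟨iff_of_true hy h, hy.ne⟩
    · exact Eventually.of_forall fun y h' => absurd h h'
    · filter_upwards [gt_mem_nhds h] with y hy _ using ⟨iff_of_false hy.not_gt h.not_gt, hy.ne'⟩
  have hconst : g a = g b := by
    refine isPreconnected_Icc.induction₂ (s := Icc a b) (fun x y => g x = g y) ?_
      (fun _ _ _ _ _ _ => Eq.trans) (fun _ _ _ _ => Eq.symm) (left_mem_Icc.2 hab)
      (right_mem_Icc.2 hab)
    intro x hx
    by_cases hxd : ∀ d, τ d ≠ x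
    · refine nhdsWithin_le_nhds ?_
      filter_upwards [hlt x, hloc x hx hxd] with y hy hfy
      rw [hg₁ x hxd, hg₁ y fun d => (hy d (hxd d)).2, hfy]
      congr 1
      exact Finset.sum_congr rfl fun d _ => by simp only [(hy d (hxd d)).1]
    · push Not at hxd
      obtain ⟨d₀, rfl⟩ := hxd
      refine nhdsWithin_le_nhds ?_
      have h1 := eventually_nhdsWithin_iff.1 (hl d₀)
      have h2 := eventually_nhdsWithin_iff.1 (hr d₀)
      filter_upwards [hlt (τ d₀), h1, h2] with y hy hly hry
      rcases lt_trichotomy y (τ d₀) with h | h | h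
      · have hyd : ∀ d, τ d ≠ y := fun d => by
          by_cases hd : d = d₀
          · rw [hd]; exact h.ne'
          · exact (hy d fun h => hd (hτ h)).2
        rw [hg₂, hg₁ y hyd, hry h]
        congr 1
        refine Finset.sum_congr rfl fun d _ => ?_
        by_cases hd : d = d₀
        · subst hd; simp [h.le]
        · simp only [(hy d fun h => hd (hτ h)).1]
      · rw [h]
      · have hyd : ∀ d, τ d ≠ y := fun d => by
          by_cases hd : d = d₀
          · rw [hd]; exact h.ne
          · exact (hy d fun h => hd (hτ h)).2
        rw [hg₂, hg₁ y hyd, hly h]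
        have : (∑ d, if τ d < y then l d - r d else 0)
            = (∑ d, if τ d < τ d₀ then l d - r d else 0) + (l d₀ - r d₀) := by
          rw [← Finset.sum_erase_add _ _ (Finset.mem_univ d₀),
            ← Finset.sum_erase_add (a := d₀) Finset.univ
              (fun d => if τ d < τ d₀ then l d - r d else 0) (Finset.mem_univ d₀)]
          simp only [h, if_true, lt_irrefl, if_false, add_zero]
          congr 1
          refine Finset.sum_congr rfl fun d hd => ?_
          simp only [(hy d fun h => Finset.ne_of_mem_erase hd (hτ h)).1]
        rw [this]; abel
  rw [hg₁ a fun d => (hmem d).1.ne', hg₁ b fun d => (hmem d).2.ne] at hconst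
  have h1 : (∑ d, if τ d < a then l d - r d else 0) = 0 :=
    Finset.sum_eq_zero fun d _ => if_neg (hmem d).1.le.not_gt
  have h2 : (∑ d, if τ d < b then l d - r d else 0) = ∑ d, (l d - r d) :=
    Finset.sum_congr rfl fun d _ => if_pos (hmem d).2
  rw [h1, h2, sub_zero] at hconst
  rw [hconst]; abel

theorem exists_mem_Ioc_circleMap_eq (z : ℂ) (r θ₀ θ : ℝ) :
    ∃ θ' ∈ Ioc θ₀ (θ₀ + 2 * Real.pi), circleMap z r θ' = circleMap z r θ := by
  refine ⟨toIocMod Real.two_pi_pos θ₀ θ, toIocMod_mem_Ioc .., ?_⟩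
  rw [toIocMod]
  exact (periodic_circleMap z r).sub_zsmul_eq _

theorem sub_eq_of_circleMap_mem_openSegment {z w : ℂ} {r θ : ℝ} (hr : 0 < r)
    (h : circleMap z r θ ∈ openSegment ℝ z w) :
    ∃ k : ℝ, 0 < k ∧ w - z = k * Complex.exp (θ * Complex.I) := by
  rw [openSegment_eq_image_lineMap] at h
  obtain ⟨t, ht, h⟩ := h
  refine ⟨r / t, div_pos hr ht.1, ?_⟩
  simp only [AffineMap.lineMap_apply, vsub_eq_sub, vadd_eq_add, Complex.real_smul, circleMap] at h
  have ht' : (t : ℂ) ≠ 0 := by exact_mod_cast ht.1.ne'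
  push_cast
  field_simp
  linear_combination h

theorem circleMap_eq_of_mem_openSegment {z w : ℂ} {r θ θ' : ℝ} (hr : 0 < r)
    (h : circleMap z r θ ∈ openSegment ℝ z w) (h' : circleMap z r θ' ∈ openSegment ℝ z w) :
    circleMap z r θ = circleMap z r θ' := by
  obtain ⟨k, hk, h1⟩ := sub_eq_of_circleMap_mem_openSegment hr h
  obtain ⟨k', hk', h2⟩ := sub_eq_of_circleMap_mem_openSegment hr h'
  have h3 := congrArg norm (h1.symm.trans h2)
  simp only [norm_mul, Complex.norm_real, Complex.norm_exp_ofReal_mul_I, mul_one,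
    Real.norm_of_nonneg hk.le, Real.norm_of_nonneg hk'.le] at h3
  subst h3
  have hk' : (k : ℂ) ≠ 0 := by exact_mod_cast hk.ne'
  simp only [circleMap, mul_left_cancel₀ hk' (h1.symm.trans h2)]

/-- The quotient is (r/k) exp(i(θ' - θ)). For r > 0, the sign of the sine then shows that angles
slightly above θ lie to the left of the dart from z to w and angles slightly below lie to its right.
-/
theorem circleMap_sub_div_im {z w : ℂ} {r θ k : ℝ} (hk : 0 < k)
    (h : w - z = k * Complex.exp (θ * Complex.I)) (θ' : ℝ) :
    ((circleMap z r θ' - z) / (w - z)).im = r / k * Real.sin (θ' - θ) := by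
  have hk' : (k : ℂ) ≠ 0 := by exact_mod_cast hk.ne'
  have : (circleMap z r θ' - z) / (w - z)
      = ((r / k : ℝ) : ℂ) * Complex.exp ((θ' - θ : ℝ) * Complex.I) := by
    rw [h, circleMap_sub_center, circleMap_zero]
    push_cast
    rw [sub_mul, Complex.exp_sub]
    field_simp
  rw [this, Complex.im_ofReal_mul, Complex.exp_ofReal_mul_I_im]

theorem tendsto_circleMap_leftSide {z w : ℂ} {r θ : ℝ} (hr : 0 < r)
    (h : circleMap z r θ ∈ openSegment ℝ z w) :
    Tendsto (circleMap z r) (𝓝[>] θ) (𝓝[leftSide z w] (circleMap z r θ)) := by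
  obtain ⟨k, hk, hw⟩ := sub_eq_of_circleMap_mem_openSegment hr h
  refine tendsto_nhdsWithin_iff.2 ⟨((continuous_circleMap z r).tendsto θ).mono_left
    nhdsWithin_le_nhds, ?_⟩
  filter_upwards [Ioo_mem_nhdsGT (show θ < θ + Real.pi by linarith [Real.pi_pos])] with θ' hθ'
  rw [mem_leftSide, circleMap_sub_div_im hk hw]
  exact mul_pos (div_pos hr hk)
    (Real.sin_pos_of_pos_of_lt_pi (by linarith [hθ'.1]) (by linarith [hθ'.2]))

theorem leftSide_swap {z w p : ℂ} (hzw : z ≠ w) :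
    p ∈ leftSide w z ↔ ((p - z) / (w - z)).im < 0 := by
  have hw : w - z ≠ 0 := sub_ne_zero.2 hzw.symm
  have hz : z - w ≠ 0 := sub_ne_zero.2 hzw
  have : (p - w) / (z - w) = 1 - (p - z) / (w - z) := by
    rw [← neg_sub w z, div_neg, eq_sub_iff_add_eq]
    field_simp
    ring
  rw [mem_leftSide, this]
  simp

theorem tendsto_circleMap_rightSide {z w : ℂ} {r θ : ℝ} (hzw : z ≠ w) (hr : 0 < r)
    (h : circleMap z r θ ∈ openSegment ℝ z w) :
    Tendsto (circleMap z r) (𝓝[<] θ) (𝓝[leftSide w z] (circleMap z r θ)) := by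
  obtain ⟨k, hk, hw⟩ := sub_eq_of_circleMap_mem_openSegment hr h
  refine tendsto_nhdsWithin_iff.2 ⟨((continuous_circleMap z r).tendsto θ).mono_left
    nhdsWithin_le_nhds, ?_⟩
  filter_upwards [Ioo_mem_nhdsLT (show θ - Real.pi < θ by linarith [Real.pi_pos])] with θ' hθ'
  rw [leftSide_swap hzw, circleMap_sub_div_im hk hw]
  exact mul_neg_of_pos_of_neg (div_pos hr hk)
    (Real.sin_neg_of_neg_of_neg_pi_lt (by linarith [hθ'.2]) (by linarith [hθ'.1]))

namespace SegmentArrangement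

variable {S : Type*} (𝒜 : SegmentArrangement S)

theorem dart_eq_of_mem {d d' : S × Bool} (h : 𝒜.tail d = 𝒜.tail d') {p : ℂ}
    (hp : p ∈ openSegment ℝ (𝒜.tail d) (𝒜.head d))
    (hp' : p ∈ openSegment ℝ (𝒜.tail d') (𝒜.head d')) : d = d' := by
  rw [openSegment_dart] at hp hp'
  have := 𝒜.eq_of_mem _ _ p hp hp'
  obtain ⟨s, b⟩ := d
  obtain ⟨s', b'⟩ := d'
  simp only at this
  subst this
  have hne := 𝒜.fst_ne_snd s
  cases b <;> cases b' <;> simp_all [tail]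

variable [Finite S]

/-- A small circle around a node meets the arrangement exactly in one interior point of each dart
that starts at the node. -/
theorem exists_radius {z : ℂ} (hz : z ∈ 𝒜.nodes) :
    ∃ r > 0, (∀ θ, circleMap z r θ ∈ 𝒜.carrier →
        ∃ d, 𝒜.tail d = z ∧ circleMap z r θ ∈ openSegment ℝ (𝒜.tail d) (𝒜.head d)) ∧
      ∀ d, 𝒜.tail d = z → ∃ θ, circleMap z r θ ∈ openSegment ℝ (𝒜.tail d) (𝒜.head d) := by
  -- This closed set is everything that does not touch z; a disc around z avoiding it meets only
  -- segments that end at z.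
  have hc : IsClosed (𝒜.nodes \ {z} ∪
      ⋃ s : {s // z ∉ segment ℝ (𝒜.fst s) (𝒜.snd s)}, segment ℝ (𝒜.fst s) (𝒜.snd s)) :=
    (𝒜.nodes_finite.subset sdiff_subset).isClosed.union
      (isClosed_iUnion_of_finite fun _ => (isCompact_segment_complex _ _).isClosed)
  have hz' : z ∉ 𝒜.nodes \ {z} ∪
      ⋃ s : {s // z ∉ segment ℝ (𝒜.fst s) (𝒜.snd s)}, segment ℝ (𝒜.fst s) (𝒜.snd s) := by
    simp
  obtain ⟨κ, hκ, hball⟩ := Metric.eventually_nhds_iff_ball.1 (hc.isOpen_compl.mem_nhds hz')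
  have hlen : ∀ᶠ r : ℝ in 𝓝[>] 0, ∀ d, 𝒜.tail d = z → r < ‖𝒜.head d - z‖ := by
    refine eventually_all.2 fun d => ?_
    by_cases hd : 𝒜.tail d = z
    · have : 0 < ‖𝒜.head d - z‖ := norm_pos_iff.2 (sub_ne_zero.2 (hd ▸ (𝒜.tail_ne_head d).symm))
      filter_upwards [nhdsWithin_le_nhds (gt_mem_nhds this)] with r hr _ using hr
    · exact Eventually.of_forall fun _ h => absurd h hd
  obtain ⟨r, hr, hr0, hrκ⟩ := (hlen.and (Ioo_mem_nhdsGT hκ)).exists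
  refine ⟨r, hr0, fun θ hθ => ?_, fun d hd => ?_⟩
  · have hb : circleMap z r θ ∈ Metric.ball z κ := by
      have := circleMap_mem_sphere z hr0.le θ
      rw [mem_sphere_iff_norm] at this
      rw [mem_ball_iff_norm, this]; exact hrκ
    have hne : circleMap z r θ ≠ z := circleMap_ne_center hr0.ne'
    have hn := hball _ hb
    have hnode : circleMap z r θ ∉ 𝒜.nodes := fun h => hn (Or.inl ⟨h, hne⟩)
    rcases hθ with h | h
    · exact absurd h hnode
    · obtain ⟨s, hs⟩ := mem_iUnion.1 h
      have hzs : z ∈ segment ℝ (𝒜.fst s) (𝒜.snd s) := by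
        by_contra hzs
        exact hn (Or.inr (mem_iUnion.2 ⟨⟨s, hzs⟩, hs⟩))
      have hs' := (𝒜.segment_subset s hs).resolve_left hnode
      rw [← insert_endpoints_openSegment] at hzs
      rcases hzs with h | h | h
      · exact ⟨(s, true), h.symm, by rwa [openSegment_dart]⟩
      · exact ⟨(s, false), h.symm, by rwa [openSegment_dart]⟩
      · exact absurd hz (𝒜.notMem_nodes s z h)
  · have hpos : 0 < ‖𝒜.head d - z‖ := hr0.trans (hr d hd)
    refine ⟨(𝒜.head d - z).arg, ?_⟩
    rw [openSegment_eq_image_lineMap, hd]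
    refine ⟨r / ‖𝒜.head d - z‖, ⟨div_pos hr0 hpos, (div_lt_one hpos).2 (hr d hd)⟩, ?_⟩
    have h1 := Complex.norm_mul_exp_arg_mul_I (𝒜.head d - z)
    have hpos' : (‖𝒜.head d - z‖ : ℂ) ≠ 0 := by exact_mod_cast hpos.ne'
    simp only [AffineMap.lineMap_apply, vsub_eq_sub, vadd_eq_add, Complex.real_smul, circleMap]
    rw [add_comm]
    congr 1
    push_cast
    field_simp
    linear_combination (-(r : ℂ)) * h1

theorem eventually_circleMap_mem_left {d : S × Bool} {r θ : ℝ} (hr : 0 < r)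
    (h : circleMap (𝒜.tail d) r θ ∈ openSegment ℝ (𝒜.tail d) (𝒜.head d)) :
    ∀ᶠ θ' in 𝓝[>] θ, circleMap (𝒜.tail d) r θ' ∈ 𝒜.left d :=
  (tendsto_circleMap_leftSide hr h).eventually (𝒜.eventually_mem_left d h)

theorem eventually_circleMap_mem_left_rev {d : S × Bool} {r θ : ℝ} (hr : 0 < r)
    (h : circleMap (𝒜.tail d) r θ ∈ openSegment ℝ (𝒜.tail d) (𝒜.head d)) :
    ∀ᶠ θ' in 𝓝[<] θ, circleMap (𝒜.tail d) r θ' ∈ 𝒜.left (d.1, !d.2) :=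
  (tendsto_circleMap_rightSide (𝒜.tail_ne_head d) hr h).eventually (𝒜.eventually_mem_left_rev d h)

/-- The sectors around a node in which exactly two darts start. -/
theorem left_eq_left_rev_of_two_darts {d₁ d₂ : S × Bool} (hne : d₁ ≠ d₂)
    (h₁₂ : 𝒜.tail d₁ = 𝒜.tail d₂)
    (hd : ∀ d, 𝒜.tail d = 𝒜.tail d₁ → d = d₁ ∨ d = d₂) :
    𝒜.left d₁ = 𝒜.left (d₂.1, !d₂.2) := by
  have hz : 𝒜.tail d₁ ∈ 𝒜.nodes := by
    rcases d₁ with ⟨s, _ | _⟩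
    exacts [𝒜.snd_mem s, 𝒜.fst_mem s]
  obtain ⟨r, hr, hcar, hex⟩ := 𝒜.exists_radius hz
  obtain ⟨θ₁, hθ₁⟩ := hex d₁ rfl
  obtain ⟨θ, hθ⟩ := hex d₂ h₁₂.symm
  obtain ⟨θ₂, hθ₂, he⟩ := exists_mem_Ioc_circleMap_eq (𝒜.tail d₁) r θ₁ θ
  rw [← he] at hθ
  -- The open arc from the first dart counterclockwise to the second meets no dart, so it joins the
  -- left of the first to the right of the second.
  have hlt : ∀ θ ∈ Ioo θ₁ θ₂, circleMap (𝒜.tail d₁) r θ ∈ 𝒜.carrierᶜ := by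
    intro φ hφ hX
    obtain ⟨d, hdz, hdm⟩ := hcar φ hX
    have hθ₂' := hθ₂.2
    rcases hd d hdz with rfl | rfl
    · have h := circleMap_eq_of_mem_openSegment hr hdm hθ₁
      have := eq_of_circleMap_eq hr.ne' (by rw [abs_lt]; constructor <;> linarith [hφ.1, hφ.2]) h
      exact hφ.1.ne' this
    · rw [← h₁₂] at hdm hθ
      have h := circleMap_eq_of_mem_openSegment hr hdm hθ
      have := eq_of_circleMap_eq hr.ne' (by rw [abs_lt]; constructor <;> linarith [hφ.1, hφ.2]) h
      exact hφ.2.ne this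
  have h1 := 𝒜.eventually_circleMap_mem_left hr hθ₁
  have h2 := 𝒜.eventually_circleMap_mem_left_rev (d := d₂) hr (by rwa [← h₁₂] at hθ ⊢)
  rw [← h₁₂] at h2
  obtain ⟨φ₁, hφ₁, hI₁⟩ := (h1.and (Ioo_mem_nhdsGT hθ₂.1)).exists
  obtain ⟨φ₂, hφ₂, hI₂⟩ := (h2.and (Ioo_mem_nhdsLT hθ₂.1)).exists
  exact (𝒜.isComponent_left d₁).eq_of_isPreconnected (𝒜.isComponent_left _)
    (isPreconnected_Ioo.image _ (continuous_circleMap _ r).continuousOn)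
    (image_subset_iff.2 hlt) hφ₁ (mem_image_of_mem _ hI₁) hφ₂ (mem_image_of_mem _ hI₂)

end SegmentArrangement

namespace SegmentArrangement

open Classical in
/-- Going around a node, the jumps of a function of the components add up to zero. -/
theorem sum_jumps_at_node {S : Type*} [Fintype S] (𝒜 : SegmentArrangement S) {M : Type*}
    [AddCommGroup M] (h : Set ℂ → M) {z : ℂ}
    (hz : z ∈ 𝒜.nodes) :
    ∑ d : S × Bool with 𝒜.tail d = z, (h (𝒜.left d) - h (𝒜.left (d.1, !d.2))) = 0 := by
  obtain ⟨r, hr, hcar, hex⟩ := 𝒜.exists_radius hz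
  choose! θ hθ using hex
  -- The circle meets each of the finitely many darts at most once, so some angle is free and can
  -- serve as the start of a full turn.
  obtain ⟨θ₀, hθ₀⟩ : ∃ θ₀, circleMap z r θ₀ ∉ 𝒜.carrier := by
    by_contra! hall
    have hfin : (circleMap z r '' Ioo 0 1).Finite := by
      refine (Set.finite_range fun d => circleMap z r (θ d)).subset ?_
      rintro _ ⟨φ, -, rfl⟩
      obtain ⟨d, hd, hm⟩ := hcar φ (hall φ)
      have := hθ d hd
      rw [hd] at hm this
      exact ⟨d, circleMap_eq_of_mem_openSegment hr this hm⟩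
    refine (Ioo_infinite (zero_lt_one (α := ℝ))) (hfin.of_finite_image ?_)
    intro x hx y hy hxy
    exact eq_of_circleMap_eq hr.ne' (by
      rw [abs_lt]; constructor <;> linarith [hx.1, hx.2, hy.1, hy.2, Real.pi_gt_three]) hxy
  have hτ' : ∀ d, ∃ τ ∈ Ioc θ₀ (θ₀ + 2 * Real.pi), circleMap z r τ = circleMap z r (θ d) :=
    fun d => exists_mem_Ioc_circleMap_eq z r θ₀ (θ d)
  choose τ hτI hτ using hτ'
  have hper := periodic_circleMap z r θ₀
  have hmem : ∀ d, 𝒜.tail d = z →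
      circleMap z r (τ d) ∈ openSegment ℝ (𝒜.tail d) (𝒜.head d) := fun d hd => by
    rw [hτ d]; exact hθ d hd
  have hlt : ∀ d, 𝒜.tail d = z → τ d < θ₀ + 2 * Real.pi := by
    intro d hd
    refine lt_of_le_of_ne (hτI d).2 fun he => hθ₀ ?_
    have := hmem d hd
    rw [he, hper, openSegment_dart] at this
    exact Or.inr (mem_iUnion.2 ⟨_, openSegment_subset_segment _ _ _ this⟩)
  -- Over a full turn the component returns to itself, so the total change is zero.
  have key := sub_eq_sum_jumps (T := {d : S × Bool // 𝒜.tail d = z}) (τ := fun d => τ d)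
    (a := θ₀) (b := θ₀ + 2 * Real.pi)
    (f := fun φ => h (connectedComponentIn 𝒜.carrierᶜ (circleMap z r φ)))
    (l := fun d => h (𝒜.left d)) (r := fun d => h (𝒜.left (d.1.1, !d.1.2)))
    ?_ (by linarith [Real.pi_pos]) (fun d => ⟨(hτI d).1, hlt d d.2⟩) ?_ ?_ ?_
  · simp only [hper, sub_self] at key
    rw [key]
    exact (Finset.sum_subtype (Finset.univ.filter fun d : S × Bool => 𝒜.tail d = z)
      (by simp) (fun d => h (𝒜.left d) - h (𝒜.left (d.1, !d.2))))
  · rintro ⟨d, hd⟩ ⟨d', hd'⟩ hdd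
    simp only at hdd
    refine Subtype.ext (𝒜.dart_eq_of_mem (hd.trans hd'.symm) (hmem d hd) ?_)
    rw [hdd]
    exact hmem d' hd'
  · rintro ⟨d, hd⟩
    subst hd
    filter_upwards [𝒜.eventually_circleMap_mem_left hr (hmem d rfl)] with φ hφ
    obtain ⟨w, -, hw⟩ := 𝒜.isComponent_left d
    rw [hw] at hφ ⊢
    rw [connectedComponentIn_eq hφ]
  · rintro ⟨d, hd⟩
    subst hd
    filter_upwards [𝒜.eventually_circleMap_mem_left_rev hr (hmem d rfl)] with φ hφ
    obtain ⟨w, -, hw⟩ := 𝒜.isComponent_left (d.1, !d.2)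
    rw [hw] at hφ ⊢
    rw [connectedComponentIn_eq hφ]
  · intro x hx hxd
    have hU : circleMap z r x ∈ 𝒜.carrierᶜ := by
      intro hX
      obtain ⟨d, hd, hdm⟩ := hcar x hX
      have hm := hmem d hd
      rw [hd] at hm hdm
      have hI := hτI d
      have hl := hlt d hd
      rcases hx.1.eq_or_lt with rfl | hx1
      · exact hθ₀ hX
      · exact hxd ⟨d, hd⟩ (eq_of_circleMap_eq hr.ne'
          (by rw [abs_lt]; constructor <;> linarith [hx.2, hI.1])
          (circleMap_eq_of_mem_openSegment hr hm hdm))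
    have hopen : IsOpen (connectedComponentIn 𝒜.carrierᶜ (circleMap z r x)) :=
      𝒜.isClosed_carrier.isOpen_compl.connectedComponentIn
    filter_upwards [(continuous_circleMap z r).continuousAt.preimage_mem_nhds
      (hopen.mem_nhds (mem_connectedComponentIn hU))] with y hy
    rw [connectedComponentIn_eq hy]

end SegmentArrangement

/-! ### Winding numbers -/

/-- If the quotient is a real number ρ ≤ 0, then p is the convex combination of a and b with weights
-ρ/(1 - ρ) and 1/(1 - ρ). Hence the branch cut of the logarithm is confined to the segment. -/
theorem div_mem_slitPlane_of_notMem_segment {a b p : ℂ} (hp : p ∉ segment ℝ a b) :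
    (b - p) / (a - p) ∈ Complex.slitPlane := by
  by_contra h
  rw [Complex.mem_slitPlane_iff, not_or, not_lt, not_not] at h
  have ha : a - p ≠ 0 := fun h' => hp (sub_eq_zero.1 h' ▸ left_mem_segment ℝ a b)
  obtain ⟨hre, him⟩ := h
  set ρ := ((b - p) / (a - p)).re with hρ
  have h1 : b - p = ρ * (a - p) := by
    rw [← div_eq_iff ha]
    exact Complex.ext (by simp [hρ]) (by simp [him])
  have hpos : 0 < 1 - ρ := by linarith
  refine hp ⟨-ρ / (1 - ρ), 1 / (1 - ρ), div_nonneg (by linarith) hpos.le, by positivity, ?_, ?_⟩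
  · field_simp; ring
  · have hne : (1 - ρ : ℂ) ≠ 0 := by exact_mod_cast hpos.ne'
    simp only [Complex.real_smul]
    push_cast
    field_simp
    linear_combination h1

theorem hasDerivAt_log_div {a b p : ℂ} (hp : p ∉ segment ℝ a b) :
    HasDerivAt (fun p => Complex.log ((b - p) / (a - p))) ((p - b)⁻¹ - (p - a)⁻¹) p := by
  have ha : a - p ≠ 0 := fun h' => hp (sub_eq_zero.1 h' ▸ left_mem_segment ℝ a b)
  have hb : b - p ≠ 0 := fun h' => hp (sub_eq_zero.1 h' ▸ right_mem_segment ℝ a b)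
  have h : HasDerivAt (fun p => (b - p) / (a - p))
      ((-1 * (a - p) - (b - p) * -1) / (a - p) ^ 2) p :=
    ((hasDerivAt_id p).const_sub b).div ((hasDerivAt_id p).const_sub a) ha
  convert h.clog (div_mem_slitPlane_of_notMem_segment hp) using 1
  rw [← neg_sub b p, ← neg_sub a p]
  field_simp

/-- This normalizes the winding function to be zero on unbounded components. -/
theorem tendsto_log_div_cobounded (a b : ℂ) :
    Tendsto (fun p => Complex.log ((b - p) / (a - p))) (Bornology.cobounded ℂ) (𝓝 0) := by
  have h1 : Tendsto (fun p : ℂ => a - p) (Bornology.cobounded ℂ) (Bornology.cobounded ℂ) :=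
    tendsto_const_sub_cobounded a
  have h2 : Tendsto (fun p : ℂ => 1 + (b - a) * (a - p)⁻¹) (Bornology.cobounded ℂ) (𝓝 1) := by
    simpa [Function.comp_def] using
      ((tendsto_inv₀_cobounded.comp h1).const_mul (b - a)).const_add 1
  have h3 : Tendsto (fun p : ℂ => (b - p) / (a - p)) (Bornology.cobounded ℂ) (𝓝 1) := by
    refine h2.congr' ?_
    filter_upwards [Bornology.isBounded_def.1 (Bornology.isBounded_singleton (x := a))] with p hp
    have : a - p ≠ 0 := fun h => hp (sub_eq_zero.1 h).symm
    field_simp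
    ring
  have := (continuousAt_clog (x := 1) (by simp)).tendsto.comp h3
  simpa [Function.comp_def] using this

theorem tendsto_div_midpoint {a b : ℂ} (hab : a ≠ b) :
    Tendsto (fun p => (b - p) / (a - p)) (𝓝 (midpoint ℝ a b)) (𝓝 (-1)) := by
  have h0 : midpoint ℝ a b = (a + b) / 2 := by
    rw [midpoint_eq_smul_add, Complex.real_smul]; simp; ring
  have ha : a - midpoint ℝ a b ≠ 0 := by
    rw [h0]
    intro h
    exact hab (by linear_combination 2 * h)
  have : (b - midpoint ℝ a b) / (a - midpoint ℝ a b) = -1 := by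
    rw [div_eq_iff ha, h0]; ring
  rw [← this]
  exact ((continuous_const.sub continuous_id).continuousAt.div
    (continuous_const.sub continuous_id).continuousAt ha).tendsto

theorem div_im_pos_of_mem_leftSide {a b p : ℂ} (hab : a ≠ b) (hp : p ∈ leftSide a b) :
    0 < ((b - p) / (a - p)).im := by
  rw [mem_leftSide] at hp
  have hab' : b - a ≠ 0 := sub_ne_zero.2 hab.symm
  set q := (p - a) / (b - a) with hq
  have hq0 : q ≠ 0 := by rintro h; simp [h] at hp
  have hpa : a - p ≠ 0 := by
    intro h
    exact hq0 (by rw [hq, ← neg_sub a p, h]; simp)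
  have : (b - p) / (a - p) = 1 - q⁻¹ := by
    have : p - a ≠ 0 := by rw [← neg_sub]; exact neg_ne_zero.2 hpa
    rw [hq, inv_div, ← neg_sub p a, div_neg, eq_sub_iff_add_eq]
    field_simp
    ring
  rw [this, Complex.sub_im, Complex.one_im, Complex.inv_im]
  have := div_pos hp (Complex.normSq_pos.2 hq0)
  rw [neg_div]; linarith

/-- The quotient tends to -1 from the upper half plane. From the other side of the segment it comes
from below, so the logarithm jumps by 2πi. -/
theorem tendsto_log_div_leftSide {a b : ℂ} (hab : a ≠ b) :
    Tendsto (fun p => Complex.log ((b - p) / (a - p))) (𝓝[leftSide a b] (midpoint ℝ a b))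
      (𝓝 (Real.pi * Complex.I)) := by
  have h := Complex.tendsto_log_nhdsWithin_im_nonneg_of_re_neg_of_im_zero (z := -1) (by simp)
    (by simp)
  have h' : Tendsto (fun p => (b - p) / (a - p)) (𝓝[leftSide a b] (midpoint ℝ a b))
      (𝓝[{z | 0 ≤ z.im}] (-1)) :=
    tendsto_nhdsWithin_iff.2 ⟨(tendsto_div_midpoint hab).mono_left nhdsWithin_le_nhds, by
      filter_upwards [self_mem_nhdsWithin] with p hp using (div_im_pos_of_mem_leftSide hab hp).le⟩
  simpa [Function.comp_def] using h.comp h'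

theorem tendsto_log_div_rightSide {a b : ℂ} (hab : a ≠ b) :
    Tendsto (fun p => Complex.log ((b - p) / (a - p))) (𝓝[leftSide b a] (midpoint ℝ a b))
      (𝓝 (-(Real.pi * Complex.I))) := by
  have h := Complex.tendsto_log_nhdsWithin_im_neg_of_re_neg_of_im_zero (z := -1) (by simp)
    (by simp)
  have h' : Tendsto (fun p => (b - p) / (a - p)) (𝓝[leftSide b a] (midpoint ℝ a b))
      (𝓝[{z | z.im < 0}] (-1)) := by
    refine tendsto_nhdsWithin_iff.2
      ⟨(tendsto_div_midpoint hab).mono_left nhdsWithin_le_nhds, ?_⟩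
    filter_upwards [self_mem_nhdsWithin] with p hp
    have h1 := div_im_pos_of_mem_leftSide hab.symm hp
    have h2 : (b - p) / (a - p) = ((a - p) / (b - p))⁻¹ := (inv_div _ _).symm
    have h0 : (a - p) / (b - p) ≠ 0 := by rintro h; simp [h] at h1
    show ((b - p) / (a - p)).im < 0
    rw [h2, Complex.inv_im]
    exact div_neg_of_neg_of_pos (by linarith) (Complex.normSq_pos.2 h0)
  simpa [Function.comp_def] using h.comp h'

namespace SegmentArrangement

variable {S : Type*} (𝒜 : SegmentArrangement S)

theorem notMem_segment {p : ℂ} (hp : p ∈ 𝒜.carrierᶜ) (s : S) :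
    p ∉ segment ℝ (𝒜.fst s) (𝒜.snd s) :=
  fun h => hp (Or.inr (mem_iUnion.2 ⟨s, h⟩))

/-- A weighting of the segments without boundary is the jump of a function of the components that
vanishes on the unbounded ones. -/
theorem exists_winding [Fintype S] (y : S → ℂ)
    (hy : ∀ g : ℂ → ℂ, ∑ s, y s * (g (𝒜.snd s) - g (𝒜.fst s)) = 0) :
    ∃ N : Set ℂ → ℂ, (∀ s, N (𝒜.left (s, true)) - N (𝒜.left (s, false)) = y s) ∧
      ∀ F, 𝒜.IsComponent F → ¬ Bornology.IsBounded F → N F = 0 := by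
  classical
  let W : ℂ → ℂ := fun p => ∑ s, y s * Complex.log ((𝒜.snd s - p) / (𝒜.fst s - p))
  have hderiv : ∀ p ∈ 𝒜.carrierᶜ, HasDerivAt W 0 p := by
    intro p hp
    have h := HasDerivAt.fun_sum (u := Finset.univ) fun s _ =>
      (hasDerivAt_log_div (𝒜.notMem_segment hp s)).const_mul (y s)
    -- The derivative is a sum of endpoint differences of x ↦ (p - x)⁻¹, which vanishes because the
    -- weighting has no boundary.
    rwa [hy fun x => (p - x)⁻¹] at h
  have hconst : ∀ F, 𝒜.IsComponent F → ∃ c, ∀ p ∈ F, W p = c := by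
    rintro F ⟨z, hz, rfl⟩
    have hsub := connectedComponentIn_subset 𝒜.carrierᶜ z
    exact 𝒜.isClosed_carrier.isOpen_compl.connectedComponentIn.exists_is_const_of_deriv_eq_zero
      isPreconnected_connectedComponentIn
      (fun p hp => (hderiv p (hsub hp)).differentiableAt.differentiableWithinAt)
      (fun p hp => (hderiv p (hsub hp)).deriv)
  choose! N hN using hconst
  have hπ : (2 * Real.pi * Complex.I : ℂ) ≠ 0 := Complex.two_pi_I_ne_zero
  refine ⟨fun F => N F / (2 * Real.pi * Complex.I), fun s => ?_, fun F hF hFb => ?_⟩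
  · set a := 𝒜.fst s
    set b := 𝒜.snd s
    have hab : a ≠ b := 𝒜.fst_ne_snd s
    set m := midpoint ℝ a b
    have hm : m ∈ openSegment ℝ a b := midpoint_mem_openSegment a b
    have hrest : Tendsto (fun p => ∑ s' ∈ Finset.univ.erase s,
        y s' * Complex.log ((𝒜.snd s' - p) / (𝒜.fst s' - p))) (𝓝 m)
        (𝓝 (∑ s' ∈ Finset.univ.erase s,
          y s' * Complex.log ((𝒜.snd s' - m) / (𝒜.fst s' - m)))) := by
      refine tendsto_finsetSum _ fun s' hs' => ?_
      have hms' : m ∉ segment ℝ (𝒜.fst s') (𝒜.snd s') := by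
        intro h
        rcases 𝒜.segment_subset s' h with h | h
        · exact 𝒜.notMem_nodes s m hm h
        · exact Finset.ne_of_mem_erase hs' (𝒜.eq_of_mem _ _ m h hm)
      exact (hasDerivAt_log_div hms').continuousAt.tendsto.const_mul (y s')
    have hW : W = fun p => (∑ s' ∈ Finset.univ.erase s,
        y s' * Complex.log ((𝒜.snd s' - p) / (𝒜.fst s' - p)))
        + y s * Complex.log ((b - p) / (a - p)) := by
      funext p
      exact (Finset.sum_erase_add _ _ (Finset.mem_univ s)).symm
    have key : ∀ (d : S × Bool) (H : Set ℂ) (c : ℂ), (𝓝[H] m).NeBot →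
        (∀ᶠ p in 𝓝[H] m, p ∈ 𝒜.left d) →
        Tendsto (fun p => Complex.log ((b - p) / (a - p))) (𝓝[H] m) (𝓝 c) →
        N (𝒜.left d) = (∑ s' ∈ Finset.univ.erase s,
          y s' * Complex.log ((𝒜.snd s' - m) / (𝒜.fst s' - m))) + y s * c := by
      intro d H c hne hev hc
      have h1 : Tendsto W (𝓝[H] m) (𝓝 (N (𝒜.left d))) := by
        refine tendsto_const_nhds.congr' ?_
        filter_upwards [hev] with p hp using (hN _ (𝒜.isComponent_left d) p hp).symm
      refine tendsto_nhds_unique h1 ?_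
      rw [hW]
      exact (hrest.mono_left nhdsWithin_le_nhds).add (hc.const_mul (y s))
    have hm' : m ∈ openSegment ℝ b a := by rwa [openSegment_symm]
    have h1 := key (s, true) _ _ (neBot_nhdsWithin_leftSide hab hm)
      (𝒜.eventually_mem_left (s, true) hm) (tendsto_log_div_leftSide hab)
    have h2 := key (s, false) _ _ (neBot_nhdsWithin_leftSide hab.symm hm')
      (𝒜.eventually_mem_left (s, false) hm') (tendsto_log_div_rightSide hab)
    simp only
    rw [h1, h2, ← sub_div, div_eq_iff hπ]
    ring
  -- An unbounded component contains points tending to infinity, where W tends to 0.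
  · have hne : (Bornology.cobounded ℂ ⊓ 𝓟 F).NeBot := by
      rw [inf_principal_neBot_iff]
      intro U hU
      by_contra h
      refine hFb (Bornology.isBounded_def.2 (mem_of_superset hU ?_))
      intro p hpU hpF
      exact h ⟨p, hpU, hpF⟩
    have h1 : Tendsto W (Bornology.cobounded ℂ ⊓ 𝓟 F) (𝓝 (N F)) := by
      refine tendsto_const_nhds.congr' ?_
      filter_upwards [mem_inf_of_right (mem_principal_self F)] with p hp using (hN F hF p hp).symm
    have h2 : Tendsto W (Bornology.cobounded ℂ ⊓ 𝓟 F) (𝓝 (∑ s, y s * 0)) :=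
      (tendsto_finsetSum _ fun s _ =>
        (tendsto_log_div_cobounded _ _).const_mul (y s)).mono_left inf_le_left
    have h3 := tendsto_nhds_unique h1 h2
    simp [h3]

end SegmentArrangement

/-- Summation by parts: group the darts by their starting node, where the jumps cancel. The two
darts of a segment have opposite jumps, which produces the difference of Q at its ends. -/
theorem SegmentArrangement.sum_jump_mul_sub_eq_zero {S R : Type*} [Fintype S] [CommRing R]
    (𝒜 : SegmentArrangement S) (h : Set ℂ → R) (Q : ℂ → R) :
    ∑ s, (h (𝒜.left (s, true)) - h (𝒜.left (s, false))) * (Q (𝒜.fst s) - Q (𝒜.snd s)) = 0 := by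
  classical
  have h1 : ∑ d : S × Bool, Q (𝒜.tail d) * (h (𝒜.left d) - h (𝒜.left (d.1, !d.2))) = 0 := by
    rw [← Finset.sum_fiberwise_of_maps_to (t := 𝒜.nodes_finite.toFinset) (g := 𝒜.tail)]
    · refine Finset.sum_eq_zero fun z hz => ?_
      have := 𝒜.sum_jumps_at_node h ((Set.Finite.mem_toFinset _).1 hz)
      rw [← mul_zero (Q z), ← this, Finset.mul_sum]
      refine Finset.sum_congr (by ext; simp) fun d hd => ?_
      rw [(Finset.mem_filter.1 hd).2]
    · rintro ⟨s, _ | _⟩ -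
      · exact (Set.Finite.mem_toFinset _).2 (𝒜.snd_mem s)
      · exact (Set.Finite.mem_toFinset _).2 (𝒜.fst_mem s)
  rw [Fintype.sum_prod_type] at h1
  rw [← h1]
  refine Finset.sum_congr rfl fun s _ => ?_
  simp only [Fintype.sum_bool, SegmentArrangement.tail, Bool.not_true, Bool.not_false, if_true]
  simp
  ring

/-! ### The two side faces of an edge -/

namespace DirGraph.PlaneDrawing

variable {V E : Type*} {G : DirGraph V E} (D : G.PlaneDrawing)

theorem corner_ne_corner_succ {e : E} {i : ℕ} (hi : i < D.len e) :
    D.corner e i ≠ D.corner e (i + 1) := by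
  intro h
  have := D.interior_injective e i (1 / 3) e i (2 / 3) hi (by norm_num) (by positivity) hi
    (by norm_num) (by positivity) (by simp [← h])
  norm_num at this

theorem corner_eq_pos_or {e : E} {j : ℕ} (hj : j ≤ D.len e) :
    (∃ v, D.corner e j = D.pos v) ∨ (0 < j ∧ j < D.len e) := by
  rcases Nat.eq_zero_or_pos j with rfl | h0
  · exact Or.inl ⟨_, D.corner_zero e⟩
  · rcases hj.eq_or_lt with rfl | h1
    · exact Or.inl ⟨_, D.corner_len e⟩
    · exact Or.inr ⟨h0, h1⟩

theorem lineMap_ne_corner {e e' : E} {i j : ℕ} {t : ℝ} (hi : i < D.len e) (ht : t ∈ Ioo (0 : ℝ) 1)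
    (hj : j ≤ D.len e') :
    AffineMap.lineMap (D.corner e i) (D.corner e (i + 1)) t ≠ D.corner e' j := by
  have h0 : 0 < (i : ℝ) + t := by have := ht.1; positivity
  rcases D.corner_eq_pos_or hj with ⟨v, hv⟩ | ⟨hj0, hj1⟩
  · rw [hv]
    exact D.interior_ne_pos e i t v hi ⟨ht.1.le, ht.2⟩ h0
  · intro h
    have := D.interior_injective e i t e' j 0 hi ⟨ht.1.le, ht.2⟩ h0 hj1 (by norm_num)
      (by simpa using hj0) (by simpa using h)
    exact ht.1.ne' this.2.2

theorem eq_of_corner_eq {e e' : E} {j k : ℕ} (hk : 0 < k) (hk' : k < D.len e)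
    (hj : j ≤ D.len e') (h : D.corner e' j = D.corner e k) : e' = e ∧ j = k := by
  rcases D.corner_eq_pos_or hj with ⟨v, hv⟩ | ⟨hj0, hj1⟩
  · exact absurd (h.symm.trans hv) (by
      simpa using D.interior_ne_pos e k 0 v hk' (by norm_num) (by simpa using hk))
  · have := D.interior_injective e' j 0 e k 0 hj1 (by norm_num) (by simpa using hj0) hk'
      (by norm_num) (by simpa using hk) (by simpa using h)
    exact ⟨this.1, this.2.1⟩

theorem point_mem_openSegment (e : E) (i : ℕ) {t : ℝ} (ht : t ∈ Ioo (0 : ℝ) 1) :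
    D.point e i t ∈ openSegment ℝ (D.corner e i) (D.corner e (i + 1)) := by
  rw [openSegment_eq_image_lineMap]
  exact mem_image_of_mem _ ht

variable [Finite V] [Finite E]

/-- The arrangement of all segments of a drawing; its nodes are the vertices and corners. -/
noncomputable def arrangement : SegmentArrangement (Σ e : E, Fin (D.len e)) where
  fst s := D.corner s.1 s.2
  snd s := D.corner s.1 (s.2 + 1)
  nodes := range D.pos ∪ (range (fun s : Σ e : E, Fin (D.len e) => D.corner s.1 s.2) ∪
    range (fun s : Σ e : E, Fin (D.len e) => D.corner s.1 (s.2 + 1)))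
  nodes_finite := (finite_range _).union ((finite_range _).union (finite_range _))
  fst_mem s := Or.inr (Or.inl ⟨s, rfl⟩)
  snd_mem s := Or.inr (Or.inr ⟨s, rfl⟩)
  fst_ne_snd s := D.corner_ne_corner_succ s.2.2
  notMem_nodes := by
    rintro ⟨e, i⟩ p hp
    rw [openSegment_eq_image_lineMap] at hp
    obtain ⟨t, ht, rfl⟩ := hp
    rintro (⟨v, hv⟩ | ⟨⟨e', j⟩, h⟩ | ⟨⟨e', j⟩, h⟩)
    · exact D.interior_ne_pos e i t v i.2 ⟨ht.1.le, ht.2⟩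
        (by have := ht.1; positivity) hv.symm
    · exact D.lineMap_ne_corner i.2 ht j.2.le h.symm
    · exact D.lineMap_ne_corner i.2 ht j.2 h.symm
  eq_of_mem := by
    rintro ⟨e, i⟩ ⟨e', i'⟩ p hp hp'
    rw [openSegment_eq_image_lineMap] at hp hp'
    obtain ⟨t, ht, rfl⟩ := hp
    obtain ⟨t', ht', h⟩ := hp'
    obtain ⟨rfl, h2, -⟩ := D.interior_injective e i t e' i' t' i.2 ⟨ht.1.le, ht.2⟩
      (by have := ht.1; positivity) i'.2 ⟨ht'.1.le, ht'.2⟩ (by have := ht'.1; positivity) h.symm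
    rw [Fin.ext h2]

theorem carrier_arrangement : D.arrangement.carrier = D.support := by
  ext p
  simp only [SegmentArrangement.carrier, arrangement, support, mem_union, mem_iUnion, mem_range,
    Sigma.exists]
  constructor
  · rintro ((h | ⟨e, i, rfl⟩ | ⟨e, i, rfl⟩) | ⟨e, i, h⟩)
    · exact Or.inl h
    · exact Or.inr ⟨e, i, i.2, left_mem_segment ..⟩
    · exact Or.inr ⟨e, i, i.2, right_mem_segment ..⟩
    · exact Or.inr ⟨e, i, i.2, h⟩
  · rintro (h | ⟨e, i, hi, h⟩)
    · exact Or.inl (Or.inl h)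
    · exact Or.inr ⟨e, ⟨i, hi⟩, h⟩

theorem isFace_iff {F : Set ℂ} : D.IsFace F ↔ D.arrangement.IsComponent F := by
  rw [IsFace, SegmentArrangement.IsComponent, carrier_arrangement]

/-- The face to the left (`b = true`) or right (`b = false`) of an edge. -/
noncomputable def sideFace (e : E) (b : Bool) : Set ℂ :=
  D.arrangement.left (⟨e, 0, D.len_pos e⟩, b)

/-- At an inner corner of an arc exactly two darts start, so the face on either side persists from
one segment to the next. -/
theorem left_succ (e : E) (i : ℕ) (hi : i + 1 < D.len e) (b : Bool) :
    D.arrangement.left (⟨e, i + 1, hi⟩, b) =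
      D.arrangement.left (⟨e, i, (Nat.lt_succ_self i).trans hi⟩, b) := by
  let d₁ : (Σ e : E, Fin (D.len e)) × Bool := (⟨e, i + 1, hi⟩, true)
  let d₂ : (Σ e : E, Fin (D.len e)) × Bool := (⟨e, i, (Nat.lt_succ_self i).trans hi⟩, false)
  have hne : d₁ ≠ d₂ := by simp [d₁, d₂]
  have ht : D.arrangement.tail d₁ = D.arrangement.tail d₂ := rfl
  have hd : ∀ d, D.arrangement.tail d = D.arrangement.tail d₁ → d = d₁ ∨ d = d₂ := by
    rintro ⟨⟨e', j⟩, _ | _⟩ h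
    · obtain ⟨rfl, h2⟩ := D.eq_of_corner_eq (Nat.succ_pos i) hi (Nat.succ_le_of_lt j.2) h
      right
      have : j = ⟨i, (Nat.lt_succ_self i).trans hi⟩ := Fin.ext (by simpa using h2)
      rw [this]
    · obtain ⟨rfl, h2⟩ := D.eq_of_corner_eq (Nat.succ_pos i) hi j.2.le h
      left
      have : j = ⟨i + 1, hi⟩ := Fin.ext h2
      rw [this]
  have h₁ := D.arrangement.left_eq_left_rev_of_two_darts hne ht hd
  have h₂ := D.arrangement.left_eq_left_rev_of_two_darts hne.symm ht.symm
    fun d h => (hd d (h.trans ht.symm)).symm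
  cases b
  · exact h₂.symm
  · exact h₁

theorem left_eq_sideFace (e : E) (i : ℕ) (hi : i < D.len e) (b : Bool) :
    D.arrangement.left (⟨e, i, hi⟩, b) = D.sideFace e b := by
  induction i with
  | zero => rfl
  | succ i ih => rw [left_succ, ih]

theorem isFace_sideFace (e : E) (b : Bool) : D.IsFace (D.sideFace e b) :=
  D.isFace_iff.2 (D.arrangement.isComponent_left _)

theorem eventually_add_normal_mem (e : E) (i : ℕ) (hi : i < D.len e) {t : ℝ}
    (ht : t ∈ Ioo (0 : ℝ) 1) :
    ∀ᶠ δ : ℝ in 𝓝[>] 0,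
      D.point e i t + (δ : ℂ) * (Complex.I * (D.corner e (i + 1) - D.corner e i))
        ∈ D.sideFace e true := by
  rw [← D.left_eq_sideFace e i hi]
  have hm := D.point_mem_openSegment e i ht
  exact (tendsto_normal_leftSide (D.corner_ne_corner_succ hi) hm).eventually
    (D.arrangement.eventually_mem_left (⟨e, i, hi⟩, true) hm)

theorem eventually_sub_normal_mem (e : E) (i : ℕ) (hi : i < D.len e) {t : ℝ}
    (ht : t ∈ Ioo (0 : ℝ) 1) :
    ∀ᶠ δ : ℝ in 𝓝[>] 0,
      D.point e i t - (δ : ℂ) * (Complex.I * (D.corner e (i + 1) - D.corner e i))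
        ∈ D.sideFace e false := by
  rw [← D.left_eq_sideFace e i hi]
  have hm := D.point_mem_openSegment e i ht
  rw [openSegment_symm] at hm
  have h := (tendsto_normal_leftSide (D.corner_ne_corner_succ hi).symm hm).eventually
    (D.arrangement.eventually_mem_left (⟨e, i, hi⟩, false) hm)
  refine h.mono fun δ hδ => ?_
  convert hδ using 1
  ring

theorem onLeft_iff {F : Set ℂ} (hF : D.IsFace F) (e : E) :
    D.OnLeft F e ↔ F = D.sideFace e true := by
  constructor
  · intro h
    have ht : (1 / 2 : ℝ) ∈ Ioo (0 : ℝ) 1 := by norm_num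
    obtain ⟨δ, h1, h2⟩ := ((h 0 (D.len_pos e) _ ht).and
      (D.eventually_add_normal_mem e 0 (D.len_pos e) ht)).exists
    exact (D.isFace_iff.1 hF).eq_of_mem (D.isFace_iff.1 (D.isFace_sideFace e true)) h1 h2
  · rintro rfl i hi t ht
    exact D.eventually_add_normal_mem e i hi ht

theorem onRight_iff {F : Set ℂ} (hF : D.IsFace F) (e : E) :
    D.OnRight F e ↔ F = D.sideFace e false := by
  constructor
  · intro h
    have ht : (1 / 2 : ℝ) ∈ Ioo (0 : ℝ) 1 := by norm_num
    obtain ⟨δ, h1, h2⟩ := ((h 0 (D.len_pos e) _ ht).and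
      (D.eventually_sub_normal_mem e 0 (D.len_pos e) ht)).exists
    exact (D.isFace_iff.1 hF).eq_of_mem (D.isFace_iff.1 (D.isFace_sideFace e false)) h1 h2
  · rintro rfl i hi t ht
    exact D.eventually_sub_normal_mem e i hi ht

open Classical in
theorem cycleBasisMatrix_eq (F : D.BoundedFace) (e : E) :
    D.cycleBasisMatrix F e = (if F.1 = D.sideFace e false then 1 else 0)
      - (if F.1 = D.sideFace e true then 1 else 0) := by
  rw [cycleBasisMatrix, D.onLeft_iff F.2.1, D.onRight_iff F.2.1]
  split_ifs <;> simp_all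

end DirGraph.PlaneDrawing

/-! ### Face boundaries, cycles and potentials -/

namespace DirGraph.PlaneDrawing

variable {V E : Type*} [Finite V] [Fintype E] {G : DirGraph V E} (D : G.PlaneDrawing)

theorem sum_segments_eq {R : Type*} [CommRing R] (y : E → R) (g : ℂ → R) :
    ∑ s, y s.1 * (g (D.arrangement.snd s) - g (D.arrangement.fst s))
      = ∑ e, y e * (g (D.pos (G.tgt e)) - g (D.pos (G.src e))) := by
  rw [Fintype.sum_sigma]
  refine Finset.sum_congr rfl fun e _ => ?_
  change ∑ i : Fin (D.len e), y e * (g (D.corner e (i + 1)) - g (D.corner e i)) = _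
  rw [← Finset.mul_sum, ← D.corner_zero, ← D.corner_len,
    Fin.sum_univ_eq_sum_range (fun i => g (D.corner e (i + 1)) - g (D.corner e i)),
    Finset.sum_range_sub fun i => g (D.corner e i)]

/-- The boundary of a bounded face is a cycle. -/
theorem sum_cycleBasisMatrix_mul_sub {K : Type*} [CommRing K] (F : D.BoundedFace) (q : V → K) :
    ∑ e, (D.cycleBasisMatrix F e : K) * (q (G.src e) - q (G.tgt e)) = 0 := by
  classical
  -- Extending q by 0 to the other points is harmless: the values at inner corners telescope away
  -- along each arc.
  have h := D.arrangement.sum_jump_mul_sub_eq_zero (fun F' => if F.1 = F' then (1 : K) else 0)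
    (Function.extend D.pos q 0)
  have h' := D.sum_segments_eq (fun e => (if F.1 = D.sideFace e false then (1 : K) else 0)
    - (if F.1 = D.sideFace e true then 1 else 0)) (Function.extend D.pos q 0)
  simp only [D.pos_injective.extend_apply] at h'
  have h1 : ∀ s, D.arrangement.left (s, true) = D.sideFace s.1 true :=
    fun s => D.left_eq_sideFace s.1 s.2 s.2.2 true
  have h2 : ∀ s, D.arrangement.left (s, false) = D.sideFace s.1 false :=
    fun s => D.left_eq_sideFace s.1 s.2 s.2.2 false
  simp only [h1, h2] at h
  have h3 : ∀ e, (D.cycleBasisMatrix F e : K) = (if F.1 = D.sideFace e false then (1 : K) else 0)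
      - (if F.1 = D.sideFace e true then 1 else 0) := by
    intro e; rw [cycleBasisMatrix_eq]; push_cast; rfl
  simp only [h3]
  rw [← neg_eq_zero, ← Finset.sum_neg_distrib]
  refine Eq.trans ?_ (h'.symm.trans (Eq.trans ?_ h))
  · exact Finset.sum_congr rfl fun e _ => by ring
  · exact Finset.sum_congr rfl fun e _ => by ring

/-- An integral cycle is the jump of a rational function of the faces that vanishes on the
unbounded faces. -/
theorem exists_rat_winding {y : E → ℤ}
    (hy : ∀ g : V → ℂ, ∑ e, (y e : ℂ) * (g (G.tgt e) - g (G.src e)) = 0) :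
    ∃ N : Set ℂ → ℚ, (∀ e, N (D.sideFace e true) - N (D.sideFace e false) = y e) ∧
      ∀ F, D.IsFace F → ¬ Bornology.IsBounded F → N F = 0 := by
  obtain ⟨N, hN, hN0⟩ := D.arrangement.exists_winding (fun s => (y s.1 : ℂ)) fun g => by
    rw [D.sum_segments_eq (fun e => (y e : ℂ))]
    exact hy fun v => g (D.pos v)
  -- A ℚ-linear retraction of ℂ onto ℚ preserves differences and fixes integers, so it makes the
  -- coefficients rational. Rationals map to every field of characteristic 0, whereas complex
  -- numbers need not.
  obtain ⟨φ, hφ⟩ := (Algebra.linearMap ℚ ℂ).exists_leftInverse_of_injective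
    (LinearMap.ker_eq_bot.2 (algebraMap ℚ ℂ).injective)
  have hφ' : ∀ n : ℤ, φ n = n := fun n => by
    have := LinearMap.congr_fun hφ (n : ℚ)
    simpa using this
  refine ⟨fun F => φ (N F), fun e => ?_, fun F hF hb => ?_⟩
  · have h : N (D.sideFace e true) - N (D.sideFace e false) = y e := hN ⟨e, 0, D.len_pos e⟩
    rw [← map_sub, h, hφ']
  · simp only [hN0 F (D.isFace_iff.1 hF) hb, map_zero]

/-- A weighting that sums to zero along the boundary of every bounded face sums to zero along
every integral cycle. -/
theorem sum_mul_cycle_eq_zero {K : Type*} [Field K] [CharZero K] {w : E → K}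
    (hw : ∀ F : D.BoundedFace, ∑ e, (D.cycleBasisMatrix F e : K) * w e = 0) {y : E → ℤ}
    (hy : ∀ g : V → ℂ, ∑ e, (y e : ℂ) * (g (G.tgt e) - g (G.src e)) = 0) :
    ∑ e, (y e : K) * w e = 0 := by
  classical
  obtain ⟨N, hN, hN0⟩ := D.exists_rat_winding hy
  have hy' : ∀ e, (y e : K) = (N (D.sideFace e true) : K) - (N (D.sideFace e false) : K) := by
    intro e
    rw [← Rat.cast_sub, hN e, Rat.cast_intCast]
  -- Only the finitely many faces adjacent to an edge matter for the sum.
  obtain ⟨T, hT, hTF⟩ : ∃ T : Finset (Set ℂ), (∀ e b, D.sideFace e b ∈ T) ∧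
      ∀ F ∈ T, D.IsFace F := by
    refine ⟨(finite_range fun d : E × Bool => D.sideFace d.1 d.2).toFinset,
      fun e b => (Finite.mem_toFinset _).2 ⟨(e, b), rfl⟩, fun F hF => ?_⟩
    obtain ⟨d, rfl⟩ := (Finite.mem_toFinset _).1 hF
    exact D.isFace_sideFace d.1 d.2
  have hsum : ∀ e b, (N (D.sideFace e b) : K)
      = ∑ F ∈ T, (N F : K) * if F = D.sideFace e b then 1 else 0 := by
    intro e b
    simp [hT]
  have hface : ∀ F ∈ T, (N F : K) * ∑ e, ((if F = D.sideFace e true then (1 : K) else 0)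
      - if F = D.sideFace e false then 1 else 0) * w e = 0 := by
    intro F hF
    by_cases hb : Bornology.IsBounded F
    · obtain ⟨F, rfl⟩ : ∃ F' : D.BoundedFace, F'.1 = F := ⟨⟨F, hTF F hF, hb⟩, rfl⟩
      rw [mul_eq_zero]
      right
      rw [← neg_eq_zero, ← Finset.sum_neg_distrib]
      refine Eq.trans (Finset.sum_congr rfl fun e _ => ?_) (hw F)
      rw [D.cycleBasisMatrix_eq]
      push_cast
      ring
    · rw [hN0 F (hTF F hF) hb]; simp
  rw [← Finset.sum_eq_zero hface]
  simp only [hy', Finset.mul_sum]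
  rw [Finset.sum_comm]
  refine Finset.sum_congr rfl fun e _ => ?_
  rw [hsum e true, hsum e false, ← Finset.sum_sub_distrib, Finset.sum_mul]
  exact Finset.sum_congr rfl fun F _ => by ring

end DirGraph.PlaneDrawing

namespace DirGraph

variable {V E : Type*} [Fintype E] {G : DirGraph V E}

/-- The chain is a signed path from u to v; its boundary is expressed by pairing with all functions
g. -/
theorem Connected.exists_chain (hG : G.Connected) (u v : V) :
    ∃ x : E → ℤ, ∀ g : V → ℂ, ∑ e, (x e : ℂ) * (g (G.tgt e) - g (G.src e)) = g v - g u := by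
  classical
  induction hG.2 u v with
  | rel u v h =>
    obtain ⟨e, rfl, rfl⟩ := h
    exact ⟨Pi.single e 1, fun g => by simp [Pi.single_apply]⟩
  | refl u => exact ⟨0, fun g => by simp⟩
  | symm u v _ ih =>
    obtain ⟨x, hx⟩ := ih
    exact ⟨-x, fun g => by simp [hx g]⟩
  | trans u v w _ _ ih ih' =>
    obtain ⟨x, hx⟩ := ih
    obtain ⟨x', hx'⟩ := ih'
    exact ⟨x + x', fun g => by simp [add_mul, Finset.sum_add_distrib, hx g, hx' g]⟩

/-- A weighting of the edges is a coboundary if it sums to zero along the boundary of every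
bounded face. -/
theorem PlaneDrawing.exists_potential [Finite V] (D : G.PlaneDrawing) (hG : G.Connected)
    {K : Type*} [Field K] [CharZero K] {w : E → K}
    (hw : ∀ F : D.BoundedFace, ∑ e, (D.cycleBasisMatrix F e : K) * w e = 0) (v₀ : V) :
    ∃ q : V → K, q v₀ = 0 ∧ ∀ e, q (G.src e) - q (G.tgt e) = w e := by
  classical
  choose x hx using fun v => hG.exists_chain v v₀
  have h0 : ∀ {y : E → ℤ}, (∀ g : V → ℂ, ∑ e, (y e : ℂ) * (g (G.tgt e) - g (G.src e)) = 0) →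
      ∑ e, (y e : K) * w e = 0 := D.sum_mul_cycle_eq_zero hw
  refine ⟨fun v => ∑ e, (x v e : K) * w e, h0 fun g => by rw [hx, sub_self], fun e => ?_⟩
  -- The path from the tail to v₀, followed backwards by the path from the head, closes up when e is
  -- removed from it.
  have := h0 (y := x (G.src e) - x (G.tgt e) - Pi.single e 1) fun g => by
    simp [sub_mul, Finset.sum_sub_distrib, hx, Pi.single_apply]
  simp only [Pi.sub_apply, Int.cast_sub, sub_mul, Finset.sum_sub_distrib] at this
  rw [sub_eq_zero] at this
  rw [this]
  simp [Pi.single_apply]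

end DirGraph

end

/-! ### Quadratic forms and splines -/

namespace DirGraph

open MvPolynomial

variable {K : Type*} [Field K]

/-- The quadratic form `q₀ x² + 2 q₁ x y + q₂ y²`. -/
noncomputable def quadForm (q₀ q₁ q₂ : K) : MvPolynomial (Fin 2) K :=
  C q₀ * X 0 ^ 2 + C (2 * q₁) * (X 0 * X 1) + C q₂ * X 1 ^ 2

theorem isHomogeneous_quadForm (q₀ q₁ q₂ : K) : (quadForm q₀ q₁ q₂).IsHomogeneous 2 := by
  refine ((IsHomogeneous.C_mul ?_ _).add (IsHomogeneous.C_mul ?_ _)).add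
    (IsHomogeneous.C_mul ?_ _)
  · exact isHomogeneous_X_pow _ _
  · exact (isHomogeneous_X K 0).mul (isHomogeneous_X K 1)
  · exact isHomogeneous_X_pow _ _

theorem quadForm_sub (p₀ p₁ p₂ q₀ q₁ q₂ : K) :
    quadForm p₀ p₁ p₂ - quadForm q₀ q₁ q₂ = quadForm (p₀ - q₀) (p₁ - q₁) (p₂ - q₂) := by
  simp only [quadForm, mul_sub, C_sub]
  ring

theorem quadForm_zero : quadForm (0 : K) 0 0 = 0 := by simp [quadForm]

theorem quadForm_eq_monomial (q₀ q₁ q₂ : K) : quadForm q₀ q₁ q₂ =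
    monomial (Finsupp.single 0 2) q₀ + monomial (Finsupp.single 0 1 + Finsupp.single 1 1) (2 * q₁)
      + monomial (Finsupp.single 1 2) q₂ := by
  rw [quadForm, X_pow_eq_monomial, X_pow_eq_monomial, X, X, monomial_mul, C_mul_monomial,
    C_mul_monomial, C_mul_monomial]
  simp

theorem coeff_quadForm_zero (q₀ q₁ q₂ : K) :
    coeff (Finsupp.single 0 2) (quadForm q₀ q₁ q₂) = q₀ := by
  rw [quadForm_eq_monomial]
  simp [coeff_monomial, Finsupp.ext_iff, Fin.forall_fin_two]

theorem coeff_quadForm_one (q₀ q₁ q₂ : K) :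
    coeff (Finsupp.single 0 1 + Finsupp.single 1 1) (quadForm q₀ q₁ q₂) = 2 * q₁ := by
  rw [quadForm_eq_monomial]
  simp [coeff_monomial, Finsupp.ext_iff, Fin.forall_fin_two]

theorem coeff_quadForm_two (q₀ q₁ q₂ : K) :
    coeff (Finsupp.single 1 2) (quadForm q₀ q₁ q₂) = q₂ := by
  rw [quadForm_eq_monomial]
  simp [coeff_monomial, Finsupp.ext_iff, Fin.forall_fin_two]

variable {V E : Type*} (G : DirGraph V E) (a : E → K)

theorem C_mul_homLabel (c : K) (e : E) :
    C c * homLabel a e = quadForm c (c * a e) (c * a e ^ 2) := by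
  simp only [homLabel, quadForm, map_mul, map_pow, map_ofNat]
  ring

theorem homLabel_eq_quadForm (e : E) : homLabel a e = quadForm 1 (a e) (a e ^ 2) := by
  simpa using C_mul_homLabel a 1 e

theorem homLabel_ne_zero (e : E) : homLabel a e ≠ 0 := by
  intro h
  have := coeff_quadForm_zero (1 : K) (a e) (a e ^ 2)
  rw [← homLabel_eq_quadForm, h] at this
  simp at this

/-- A quadratic form divisible by a label is a scalar multiple of it. -/
theorem eq_C_mul_homLabel_of_dvd {f : MvPolynomial (Fin 2) K} (hf : f.IsHomogeneous 2) {e : E}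
    (h : homLabel a e ∣ f) : f = C (coeff (Finsupp.single 0 2) f) * homLabel a e := by
  obtain ⟨g, rfl⟩ := h
  have hl := homLabel_ne_zero a e
  -- The label already has total degree 2, so the cofactor has degree 0.
  obtain ⟨c, rfl⟩ : ∃ c, g = C c := by
    by_cases hg : g = 0
    · exact ⟨0, by simp [hg]⟩
    · have h1 := hf.totalDegree (mul_ne_zero hl hg)
      have h2 : (homLabel a e).totalDegree = 2 := by
        have := isHomogeneous_quadForm (1 : K) (a e) (a e ^ 2)
        rw [← homLabel_eq_quadForm] at this
        exact this.totalDegree hl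
      rw [totalDegree_mul_of_isDomain hl hg, h2] at h1
      exact ⟨_, totalDegree_eq_zero_iff_eq_C.1 (by omega)⟩
  rw [mul_comm, C_mul_homLabel, coeff_quadForm_zero, C_mul_homLabel]

/-- The `x²`-coefficients of the differences of a vertex labelling along the edges. -/
noncomputable def edgeCoeff : (V → MvPolynomial (Fin 2) K) →ₗ[K] (E → K) where
  toFun p e := coeff (Finsupp.single 0 2) (p (G.src e) - p (G.tgt e))
  map_add' p q := by
    funext e
    simp only [Pi.add_apply, add_sub_add_comm, coeff_add]
  map_smul' c p := by
    funext e
    simp only [Pi.smul_apply, ← smul_sub, coeff_smul, RingHom.id_apply]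

theorem edgeCoeff_apply (p : V → MvPolynomial (Fin 2) K) (e : E) :
    G.edgeCoeff p e = coeff (Finsupp.single 0 2) (p (G.src e) - p (G.tgt e)) := rfl

variable {G a}

theorem mem_SplDegAt {d : ℕ} {ℓ : E → MvPolynomial (Fin 2) K} {v₀ : V}
    {p : V → MvPolynomial (Fin 2) K} : p ∈ G.SplDegAt ℓ d v₀ ↔
      (∀ e, ℓ e ∣ p (G.src e) - p (G.tgt e)) ∧ (∀ v, (p v).IsHomogeneous d) ∧ p v₀ = 0 := by
  simp only [SplDegAt, SplDeg, Submodule.mem_inf, Submodule.restrictScalars_mem, Submodule.mem_pi,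
    Set.mem_univ, true_imp_iff, mem_homogeneousSubmodule, LinearMap.mem_ker, LinearMap.proj_apply,
    and_assoc]
  rfl

/-- One scalar per edge controls all three coefficients; the factors 1, a_e, a_e² are those of the
three rows belonging to a face. -/
theorem sub_eq_of_mem_SplDegAt {v₀ : V} {p : V → MvPolynomial (Fin 2) K}
    (hp : p ∈ G.SplDegAt (homLabel a) 2 v₀) (e : E) :
    p (G.src e) - p (G.tgt e)
      = quadForm (G.edgeCoeff p e) (G.edgeCoeff p e * a e) (G.edgeCoeff p e * a e ^ 2) := by
  obtain ⟨h1, h2, -⟩ := mem_SplDegAt.1 hp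
  rw [← C_mul_homLabel]
  exact eq_C_mul_homLabel_of_dvd a ((h2 _).sub (h2 _)) (h1 e)

theorem Connected.eq_zero_of_edgeCoeff_eq_zero (hG : G.Connected) {v₀ : V}
    {p : V → MvPolynomial (Fin 2) K} (hp : p ∈ G.SplDegAt (homLabel a) 2 v₀)
    (h : G.edgeCoeff p = 0) : p = 0 := by
  have h1 : ∀ u v, p u = p v := by
    intro u v
    induction hG.2 u v with
    | rel u v h' =>
      obtain ⟨e, rfl, rfl⟩ := h'
      have := sub_eq_of_mem_SplDegAt hp e
      rw [h] at this
      simpa [quadForm_zero, sub_eq_zero] using this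
    | refl u => rfl
    | symm u v _ ih => exact ih.symm
    | trans u v w _ _ ih ih' => exact ih.trans ih'
  funext v
  rw [h1 v v₀, (mem_SplDegAt.1 hp).2.2, Pi.zero_apply]

variable [Fintype E]

theorem PlaneDrawing.mem_ker_extCycleBasisMatrix (D : G.PlaneDrawing) (c : E → K) :
    c ∈ LinearMap.ker (D.extCycleBasisMatrix a).mulVecLin ↔
      ∀ (j : Fin 3) (F : D.BoundedFace),
        ∑ e, (D.cycleBasisMatrix F e : K) * (c e * a e ^ (j : ℕ)) = 0 := by
  rw [LinearMap.mem_ker, Matrix.mulVecLin_apply, funext_iff, Prod.forall, forall_comm]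
  refine forall₂_congr fun j F => ?_
  simp only [Matrix.mulVec, dotProduct, PlaneDrawing.extCycleBasisMatrix, Pi.zero_apply]
  rw [Finset.sum_congr rfl fun e _ => by rw [mul_assoc, mul_comm (a e ^ (j : ℕ))]]

theorem PlaneDrawing.map_edgeCoeff_eq_ker [Finite V] [CharZero K] (D : G.PlaneDrawing)
    (hG : G.Connected) (v₀ : V) :
    (G.SplDegAt (homLabel a) 2 v₀).map G.edgeCoeff
      = LinearMap.ker (D.extCycleBasisMatrix a).mulVecLin := by
  ext c
  rw [D.mem_ker_extCycleBasisMatrix, Submodule.mem_map]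
  constructor
  · rintro ⟨p, hp, rfl⟩ j F
    obtain ⟨q, hq⟩ : ∃ q : V → K, ∀ e,
        q (G.src e) - q (G.tgt e) = G.edgeCoeff p e * a e ^ (j : ℕ) := by
      have h := sub_eq_of_mem_SplDegAt hp
      fin_cases j
      · refine ⟨fun v => coeff (Finsupp.single 0 2) (p v), fun e => ?_⟩
        rw [← coeff_sub, h e, coeff_quadForm_zero]; simp
      -- The xy-coefficient of `quadForm` is 2 q₁, so it must be halved, which characteristic 0
      -- permits.
      · refine ⟨fun v => coeff (Finsupp.single 0 1 + Finsupp.single 1 1) (p v) / 2, fun e => ?_⟩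
        rw [← sub_div, ← coeff_sub, h e, coeff_quadForm_one]; simp
      · refine ⟨fun v => coeff (Finsupp.single 1 2) (p v), fun e => ?_⟩
        rw [← coeff_sub, h e, coeff_quadForm_two]
    simp only [← hq]
    exact D.sum_cycleBasisMatrix_mul_sub F q
  · intro hc
    -- Each of the three weightings has a potential vanishing at v₀; together they are the
    -- coefficients of the spline.
    choose q hq0 hq using fun j => D.exists_potential hG (hc j) v₀
    have hd : ∀ e, quadForm (q 0 (G.src e)) (q 1 (G.src e)) (q 2 (G.src e))
        - quadForm (q 0 (G.tgt e)) (q 1 (G.tgt e)) (q 2 (G.tgt e))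
        = quadForm (c e) (c e * a e) (c e * a e ^ 2) := by
      intro e
      rw [quadForm_sub, hq, hq, hq]
      simp
    refine ⟨fun v => quadForm (q 0 v) (q 1 v) (q 2 v), mem_SplDegAt.2 ⟨fun e => ?_,
      fun v => isHomogeneous_quadForm _ _ _, ?_⟩, ?_⟩
    · rw [hd, ← C_mul_homLabel]
      exact dvd_mul_left _ _
    · simp only [hq0, quadForm_zero]
    · funext e
      rw [edgeCoeff_apply, hd, coeff_quadForm_zero]

end DirGraph

/-! ### The dimension count -/

theorem mainTheorem2 {K : Type*} [Field K] [CharZero K] {V E : Type*} [Fintype V] [Fintype E]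
    (G : DirGraph V E) (hG : G.Connected) (D : G.PlaneDrawing) (a : E → K) (v₀ : V) :
    (Module.finrank K (G.SplDegAt (DirGraph.homLabel a) 2 v₀) : ℤ) =
      (Fintype.card E : ℤ) - ((D.extCycleBasisMatrix a).rank : ℤ) := by
  have hinj : Function.Injective
      (G.edgeCoeff.domRestrict (G.SplDegAt (DirGraph.homLabel a) 2 v₀)) := by
    rw [← LinearMap.ker_eq_bot, LinearMap.ker_eq_bot']
    intro p hp
    exact Subtype.ext (hG.eq_zero_of_edgeCoeff_eq_zero p.2 hp)
  have h1 := LinearMap.finrank_range_of_inj hinj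
  rw [LinearMap.range_domRestrict, D.map_edgeCoeff_eq_ker hG] at h1
  -- Rank-nullity on K^E needs only finitely many columns, so the number of bounded faces plays no
  -- role.
  have h2 := LinearMap.finrank_range_add_finrank_ker (D.extCycleBasisMatrix a).mulVecLin
  rw [Module.finrank_fintype_fun_eq_card] at h2
  rw [← h1, ← h2, Matrix.rank]
  push_cast
  ring
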